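/- **Setting.** Let $f_0,f_1$ be probability densities with respect to a common reference measure $\mu$ on a measurable space (e.g. Lebesgue measure on $\mathbb R$), such that $f_1=0$ $\mu$-a.e. on $\{f_0=0\}$, and let $L=f_1/f_0$. Let $0<\rho<1$ and $0\le\pi_0<1$. The change point $\Gamma$ satisfies $\mathrm P(\Gamma=0)=\pi_0$ and $\mathrm P(\Gamma=k)=(1-\pi_0)\rho(1-\rho)^{k-1}$ for $k\ge1$. Given $\Gamma=\ell$, the observations $X_1,X_2,\dots$ are independent, $X_k$ having density $f_0$ for $k<\ell$ and $f_1$ for $k\ge\ell$; $\mathrm P_\ell$, $\mathrm E_\ell$ denote the corresponding probability and expectation, and $\mathrm P$, $\mathrm E$ those for random $\Gamma$ (so under $\mathrm P_1$ all $X_k$ are i.i.d. with density $f_1$). Put $$\Phi^{(0)}(p)=p+(1-p)\rho,\qquad \Phi^{(1)}(x,p)=\frac{\Phi^{(0)}(p)L(x)}{\Phi^{(0)}(p)L(x)+1-\Phi^{(0)}(p)} .$$ **Two-threshold policy.** For $b<a$ let $A=1/(1+e^{-a})$ and $B=1/(1+e^{-b})$. Start with $p_0=\pi_0$. For $k\ge0$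 put $S_{k+1}=1$ and $p_{k+1}=\Phi^{(1)}(X_{k+1},p_k)$ if $p_k\ge B$ (the observation is taken), and $S_{k+1}=0$ and $p_{k+1}=\Phi^{(0)}(p_k)$ if $p_k<B$ (it is skipped); put $S_0=0$. Let $\tau=\inf\{k\ge1:p_k>A\}$, and let $$\mathrm{ANO}_1=\mathrm E\Big[\sum_{k=\Gamma}^{\tau}S_k\,\Big|\,\tau\ge\Gamma\Big]$$ be the average number of observations used after the change. **Shiryaev time.** Let $q_0=B$, $q_{k+1}=\Phi^{(1)}(X_{k+1},q_k)$ (every observation is taken) and $\nu_b=\inf\{k\ge1:q_k>A\}$. **Theorem.** For all $a>b$ the quantities $\mathrm{ANO}_1$, $\mathrm E_1[\nu_b]$ and $\mathrm E[\tau-\Gamma\mid\tau\ge\Gamma]$ are finite, and for fixed $b\in\mathbb R$ and $\rho$ (and $\pi_0,f_0,f_1$), as $a\to\infty$, $$\mathrm{ANO}_1=\mathrm E_1[\nu_b]\,(1+o(1)),\qquad\text{and also}\qquad \mathrm{ANO}_1=\mathrm E[\tau-\Gamma\mid\tau\ge\Gamma]\,(1+o(1)),$$ i.e. asymptotically the average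 number of observations used after the change equals the detection delay. -/

import Mathlib

open MeasureTheory ProbabilityTheory Filter Topology Asymptotics
open scoped ENNReal

namespace QuickestChange

/-- `f` is a probability density with respect to the reference measure `μ`. -/
structure IsProbDensity {E : Type*} [MeasurableSpace E] (μ : Measure E) (f : E → ℝ) : Prop where
  measurable : Measurable f
  nonneg : ∀ x, 0 ≤ f x
  lintegral_eq_one : ∫⁻ x, ENNReal.ofReal (f x) ∂μ = 1

/-- The distribution with density `f` with respect to `μ`. -/
noncomputable def law {E : Type*} [MeasurableSpace E] (μ : Measure E) (f : E → ℝ) : Measure E :=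
  μ.withDensity fun x => ENNReal.ofReal (f x)

/-- The law of the change point `Γ`: mass `π₀` at `0`, and the rest geometric with
parameter `ρ` on `{1, 2, …}`. -/
noncomputable def prior (ρ π₀ : ℝ) (k : ℕ) : ℝ :=
  if k = 0 then π₀ else (1 - π₀) * ρ * (1 - ρ) ^ (k - 1)

/-- `P_ℓ`: the law of the observations when the change happens at time `ℓ`. The coordinates
`X_k` are independent, with density `f₀` for `k < ℓ` and `f₁` for `k ≥ ℓ`. (Observations are
`X_1, X_2, …`; the coordinate `X_0` is never used.) -/
noncomputable def changeAt {E : Type*} [MeasurableSpace E] (μ : Measure E) (f₀ f₁ : E → ℝ)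
    (ℓ : ℕ) : Measure (ℕ → E) :=
  Measure.infinitePi fun k : ℕ => if k < ℓ then law μ f₀ else law μ f₁

/-- `P`: the joint law of the change point and the observations, `ω = (Γ, (X_k)_k)`. -/
noncomputable def jointLaw {E : Type*} [MeasurableSpace E] (μ : Measure E) (f₀ f₁ : E → ℝ)
    (ρ π₀ : ℝ) : Measure (ℕ × (ℕ → E)) :=
  Measure.sum fun ℓ : ℕ =>
    ENNReal.ofReal (prior ρ π₀ ℓ) • (changeAt μ f₀ f₁ ℓ).map fun x => (ℓ, x)

/-- The likelihood ratio `L = f₁ / f₀`. -/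
noncomputable def likelihoodRatio {E : Type*} (f₀ f₁ : E → ℝ) (x : E) : ℝ := f₁ x / f₀ x

/-- Update of the a posteriori probability of change when the observation is skipped. -/
def skipUpdate (ρ p : ℝ) : ℝ := p + (1 - p) * ρ

/-- Update of the a posteriori probability of change when the observation `x` is taken. -/
noncomputable def takeUpdate {E : Type*} (f₀ f₁ : E → ℝ) (ρ : ℝ) (x : E) (p : ℝ) : ℝ :=
  skipUpdate ρ p * likelihoodRatio f₀ f₁ x /
    (skipUpdate ρ p * likelihoodRatio f₀ f₁ x + (1 - skipUpdate ρ p))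

/-- The a posteriori probability `p_k` under the two-threshold policy with observation
threshold `B`: the observation at time `k + 1` is taken iff `p_k ≥ B`. -/
noncomputable def post {E : Type*} (f₀ f₁ : E → ℝ) (ρ π₀ B : ℝ) (x : ℕ → E) : ℕ → ℝ
  | 0 => π₀
  | k + 1 =>
    if B ≤ post f₀ f₁ ρ π₀ B x k then takeUpdate f₀ f₁ ρ (x (k + 1)) (post f₀ f₁ ρ π₀ B x k)
    else skipUpdate ρ (post f₀ f₁ ρ π₀ B x k)

/-- The control `S_k`, `k ≥ 1`: it is `1` if the observation at time `k` is taken and `0`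
otherwise (there is no observation at time `0`). -/
noncomputable def control {E : Type*} (f₀ f₁ : E → ℝ) (ρ π₀ B : ℝ) (x : ℕ → E) : ℕ → ℕ
  | 0 => 0
  | k + 1 => if B ≤ post f₀ f₁ ρ π₀ B x k then 1 else 0

/-- `inf {k ≥ 1 : u_k > A}`, equal to `∞` if there is no such `k`. -/
noncomputable def firstAbove (u : ℕ → ℝ) (A : ℝ) : ℕ∞ :=
  ⨅ (k : ℕ) (_ : 1 ≤ k ∧ A < u k), (k : ℕ∞)

/-- The stopping time `τ` of the two-threshold policy `γ(a, b)`, with the thresholds given on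
the log-odds scale: `p_k > A` with `A = 1 / (1 + e^{-a})` means `log (p_k / (1 - p_k)) > a`. -/
noncomputable def tau {E : Type*} (f₀ f₁ : E → ℝ) (ρ π₀ a b : ℝ) (x : ℕ → E) : ℕ∞ :=
  firstAbove (post f₀ f₁ ρ π₀ (Real.sigmoid b) x) (Real.sigmoid a)

/-- The Shiryaev recursion (every observation is taken), started at `p`. -/
noncomputable def shiryaev {E : Type*} (f₀ f₁ : E → ℝ) (ρ p : ℝ) (x : ℕ → E) : ℕ → ℝ
  | 0 => p
  | k + 1 => takeUpdate f₀ f₁ ρ (x (k + 1)) (shiryaev f₀ f₁ ρ p x k)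

/-- `ν_b = ν(b, a)`: the time for the Shiryaev recursion to exceed `a`, starting at `b`
(both on the log-odds scale). -/
noncomputable def nu {E : Type*} (f₀ f₁ : E → ℝ) (ρ a b : ℝ) (x : ℕ → E) : ℕ∞ :=
  firstAbove (shiryaev f₀ f₁ ρ (Real.sigmoid b) x) (Real.sigmoid a)

/-- `E_1[ν_b]`. -/
noncomputable def expNu {E : Type*} [MeasurableSpace E] (μ : Measure E) (f₀ f₁ : E → ℝ)
    (ρ a b : ℝ) : ℝ≥0∞ :=
  ∫⁻ x, (nu f₀ f₁ ρ a b x : ℝ≥0∞) ∂(changeAt μ f₀ f₁ 1)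

/-- The event `{τ ≥ Γ}` that there is no false alarm. -/
def noFalseAlarm {E : Type*} (f₀ f₁ : E → ℝ) (ρ π₀ a b : ℝ) : Set (ℕ × (ℕ → E)) :=
  {ω | (ω.1 : ℕ∞) ≤ tau f₀ f₁ ρ π₀ a b ω.2}

/-- `∑_{k=Γ}^{τ} S_k`. -/
noncomputable def obsAfterChange {E : Type*} (f₀ f₁ : E → ℝ) (ρ π₀ a b : ℝ)
    (ω : ℕ × (ℕ → E)) : ℝ≥0∞ :=
  ∑' k : ℕ, if ω.1 ≤ k ∧ (k : ℕ∞) ≤ tau f₀ f₁ ρ π₀ a b ω.2 then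
    (control f₀ f₁ ρ π₀ (Real.sigmoid b) ω.2 k : ℝ≥0∞) else 0

/-- `ANO₁ = E[∑_{k=Γ}^{τ} S_k | τ ≥ Γ]`. -/
noncomputable def ano₁ {E : Type*} [MeasurableSpace E] (μ : Measure E) (f₀ f₁ : E → ℝ)
    (ρ π₀ a b : ℝ) : ℝ≥0∞ :=
  ∫⁻ ω, obsAfterChange f₀ f₁ ρ π₀ a b ω
    ∂(ProbabilityTheory.cond (jointLaw μ f₀ f₁ ρ π₀) (noFalseAlarm f₀ f₁ ρ π₀ a b))

/-- The conditional detection delay `E[τ - Γ | τ ≥ Γ]`. -/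
noncomputable def condDelay {E : Type*} [MeasurableSpace E] (μ : Measure E) (f₀ f₁ : E → ℝ)
    (ρ π₀ a b : ℝ) : ℝ≥0∞ :=
  ∫⁻ ω, ((tau f₀ f₁ ρ π₀ a b ω.2 : ℝ≥0∞) - (ω.1 : ℝ≥0∞))
    ∂(ProbabilityTheory.cond (jointLaw μ f₀ f₁ ρ π₀) (noFalseAlarm f₀ f₁ ρ π₀ a b))

end QuickestChange

/-! After the change, the inverse odds `(1 - p) / p` of the posterior contract in mean. Prior mass
flowing into the change multiplies them by at most `1 - ρ`. Taking an observation multiplies them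
further by `1 / L`, and `E_1[1 / L] ≤ 1`. So the bound holds whether or not the observation is
taken. Since one update also brings the posterior prediction to at least `ρ`, the expected inverse
odds summed over all times from the change on (from time `1` if `Γ = 0`) are at most `invOdds ρ /
ρ`, uniformly in `a` and in the change point. Each time spent below `B` contributes at least
`invOdds B` to that sum, so the expected number of skipped observations after the change is bounded
as `a → ∞`.

It remains to compare the expected time from the change to the alarm with `N = E_1[ν_b]`, which is
the expected Shiryaev hitting time `hitTime` at `B`. From above, `one_add_lintegral_superSol_le`
gives a supersolution of the first step inequality: `hitTime` at `max p s` plus a multiple of the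
inverse odds whose decrease pays for each step below `s`. With `s = B` the time to alarm is at most
`N + O(1)`. From below, `hitTime_le_stepUpdate` shows that `hitTime` is a subsolution up to a
multiple of the inverse odds, which is summable. The posterior at the change may exceed `B`, but
`hitTime` there is at least `N` minus a quantity that depends on that posterior and not on `a`.
After division by `N` this correction vanishes by dominated convergence (`tendsto_survivalRatio`).

Every posterior is below `1`, so each fixed time is eventually survived as `a → ∞`. Hence `N → ∞`
and `P(τ ≥ Γ) → 1`, and bounded errors and the conditioning are both negligible. `ANO₁` and the
delay are each equivalent to `N`, hence to each other. -/

/-! ### Resampling a coordinate of a product measure. -/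

/-- Resampling one coordinate leaves an infinite product of probability measures unchanged. -/
theorem MeasureTheory.Measure.map_update_infinitePi {ι : Type*} [DecidableEq ι] {X : ι → Type*}
    [∀ i, MeasurableSpace (X i)] (ν : ∀ i, Measure (X i)) [∀ i, IsProbabilityMeasure (ν i)]
    (i : ι) :
    ((Measure.infinitePi ν).prod (ν i)).map (fun q => Function.update q.1 i q.2) =
      Measure.infinitePi ν := by
  have hm : Measurable fun q : (∀ i, X i) × X i => Function.update q.1 i q.2 := measurable_update'
  refine Measure.eq_infinitePi ν fun s t ht => ?_
  rw [Measure.map_apply hm (MeasurableSet.pi s.countable_toSet fun j _ => ht j)]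
  have hpre : (fun q : (∀ i, X i) × X i => Function.update q.1 i q.2) ⁻¹' Set.pi s t =
      Set.pi (s.erase i : Finset ι) t ×ˢ (if i ∈ s then t i else Set.univ) := by
    ext ⟨x, y⟩
    simp only [Set.mem_preimage, Set.mem_pi, Set.mem_prod, Finset.mem_coe, Finset.mem_erase]
    constructor
    · intro h
      refine ⟨fun j hj => ?_, ?_⟩
      · simpa [Function.update_of_ne hj.1] using h j hj.2
      · split_ifs with hi
        · simpa using h i hi
        · trivial
    · rintro ⟨h1, h2⟩ j hj
      by_cases hji : j = i
      · subst hji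
        simpa [hj] using h2
      · simpa [Function.update_of_ne hji] using h1 j ⟨hji, hj⟩
  rw [hpre, Measure.prod_prod, Measure.infinitePi_pi ν fun j _ => ht j]
  by_cases hi : i ∈ s
  · rw [if_pos hi, Finset.prod_erase_mul _ _ hi]
  · rw [if_neg hi, measure_univ, mul_one, Finset.erase_eq_of_notMem hi]

theorem MeasureTheory.Measure.lintegral_infinitePi_update {ι : Type*} [DecidableEq ι]
    {X : ι → Type*} [∀ i, MeasurableSpace (X i)] (ν : ∀ i, Measure (X i))
    [∀ i, IsProbabilityMeasure (ν i)] (i : ι) {H : (∀ i, X i) → ℝ≥0∞} (hH : Measurable H) :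
    ∫⁻ x, H x ∂Measure.infinitePi ν =
      ∫⁻ x, ∫⁻ y, H (Function.update x i y) ∂ν i ∂Measure.infinitePi ν := by
  have hm : Measurable fun q : (∀ i, X i) × X i => Function.update q.1 i q.2 := measurable_update'
  conv_lhs => rw [← Measure.map_update_infinitePi ν i]
  rw [lintegral_map hH hm]
  exact lintegral_prod _ (hH.comp hm).aemeasurable

/-! ### Posterior updates and the contraction of the inverse odds. -/

namespace QuickestChange

variable {E : Type*} {f₀ f₁ : E → ℝ} {ρ : ℝ}

theorem IsProbDensity.isProbabilityMeasure_law {E : Type*} [MeasurableSpace E] {μ : Measure E}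
    {f : E → ℝ} (hf : IsProbDensity μ f) :
    IsProbabilityMeasure (law μ f) := by
  refine ⟨?_⟩
  rw [law, withDensity_apply _ MeasurableSet.univ, Measure.restrict_univ, hf.lintegral_eq_one]

theorem skipUpdate_mem (hρ₀ : 0 < ρ) (hρ₁ : ρ < 1) {p : ℝ} (hp : p ∈ Set.Ico (0 : ℝ) 1) :
    skipUpdate ρ p ∈ Set.Ioo (0 : ℝ) 1 := by
  obtain ⟨h0, h1⟩ := hp
  constructor <;> unfold skipUpdate <;> nlinarith

theorem skipUpdate_mono (hρ₁ : ρ < 1) : Monotone (skipUpdate ρ) := by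
  intro p q h
  unfold skipUpdate
  nlinarith

theorem likelihoodRatio_nonneg (h₀ : ∀ x, 0 ≤ f₀ x) (h₁ : ∀ x, 0 ≤ f₁ x) (x : E) :
    0 ≤ likelihoodRatio f₀ f₁ x := div_nonneg (h₁ x) (h₀ x)

theorem takeUpdate_mem (h₀ : ∀ x, 0 ≤ f₀ x) (h₁ : ∀ x, 0 ≤ f₁ x) (hρ₀ : 0 < ρ) (hρ₁ : ρ < 1)
    (x : E) {p : ℝ} (hp : p ∈ Set.Ico (0 : ℝ) 1) :
    takeUpdate f₀ f₁ ρ x p ∈ Set.Ico (0 : ℝ) 1 := by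
  obtain ⟨h0, h1⟩ := skipUpdate_mem hρ₀ hρ₁ hp
  have hL := likelihoodRatio_nonneg h₀ h₁ x
  have hn : 0 ≤ skipUpdate ρ p * likelihoodRatio f₀ f₁ x := mul_nonneg h0.le hL
  unfold takeUpdate
  refine ⟨div_nonneg hn (by linarith), ?_⟩
  rw [div_lt_one (by linarith)]
  linarith

theorem takeUpdate_mono (h₀ : ∀ x, 0 ≤ f₀ x) (h₁ : ∀ x, 0 ≤ f₁ x) (hρ₀ : 0 < ρ) (hρ₁ : ρ < 1)
    (x : E) {p q : ℝ} (hp : p ∈ Set.Ico (0 : ℝ) 1) (hq : q ∈ Set.Ico (0 : ℝ) 1) (hpq : p ≤ q) :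
    takeUpdate f₀ f₁ ρ x p ≤ takeUpdate f₀ f₁ ρ x q := by
  obtain ⟨hp0, hp1⟩ := skipUpdate_mem hρ₀ hρ₁ hp
  obtain ⟨hq0, hq1⟩ := skipUpdate_mem hρ₀ hρ₁ hq
  have hL := likelihoodRatio_nonneg h₀ h₁ x
  have hs := skipUpdate_mono hρ₁ hpq
  have hnp := mul_nonneg hp0.le hL
  have hnq := mul_nonneg hq0.le hL
  unfold takeUpdate
  rw [div_le_div_iff₀ (by linarith) (by linarith)]
  nlinarith [mul_le_mul_of_nonneg_right hs hL]

theorem measurable_skipUpdate : Measurable (skipUpdate ρ) := by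
  unfold skipUpdate
  fun_prop

/-- One step of the two-threshold recursion. -/
noncomputable def stepUpdate (f₀ f₁ : E → ℝ) (ρ B : ℝ) (y : E) (p : ℝ) : ℝ :=
  if B ≤ p then takeUpdate f₀ f₁ ρ y p else skipUpdate ρ p

theorem stepUpdate_mem (h₀ : ∀ x, 0 ≤ f₀ x) (h₁ : ∀ x, 0 ≤ f₁ x) (hρ₀ : 0 < ρ) (hρ₁ : ρ < 1)
    (B : ℝ) (x : E) {p : ℝ} (hp : p ∈ Set.Ico (0 : ℝ) 1) :
    stepUpdate f₀ f₁ ρ B x p ∈ Set.Ico (0 : ℝ) 1 := by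
  unfold stepUpdate
  split_ifs
  · exact takeUpdate_mem h₀ h₁ hρ₀ hρ₁ x hp
  · exact Set.Ioo_subset_Ico_self (skipUpdate_mem hρ₀ hρ₁ hp)

theorem stepUpdate_zero (x : E) {p : ℝ} (hp : 0 ≤ p) :
    stepUpdate f₀ f₁ ρ 0 x p = takeUpdate f₀ f₁ ρ x p := by
  rw [stepUpdate, if_pos hp]

variable [MeasurableSpace E] {μ : Measure E}

theorem measurable_takeUpdate (hf₀ : Measurable f₀) (hf₁ : Measurable f₁) :
    Measurable fun q : ℝ × E => takeUpdate f₀ f₁ ρ q.2 q.1 := by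
  unfold takeUpdate skipUpdate likelihoodRatio
  fun_prop

/-- The inverse odds `(1 - p) / p`, equal to `∞` at `p = 0`. -/
noncomputable def invOdds (p : ℝ) : ℝ≥0∞ := ENNReal.ofReal (1 - p) / ENNReal.ofReal p

theorem measurable_invOdds : Measurable invOdds := by
  unfold invOdds
  fun_prop

theorem invOdds_antitone : Antitone invOdds := by
  intro p q h
  unfold invOdds
  exact ENNReal.div_le_div (ENNReal.ofReal_le_ofReal (by linarith)) (ENNReal.ofReal_le_ofReal h)

theorem invOdds_pos {p : ℝ} (hp : p < 1) : invOdds p ≠ 0 := by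
  unfold invOdds
  rw [Ne, ENNReal.div_eq_zero_iff]
  simp [hp]

theorem invOdds_ne_top {p : ℝ} (hp : 0 < p) : invOdds p ≠ ∞ := by
  unfold invOdds
  exact ENNReal.div_ne_top ENNReal.ofReal_ne_top (by simpa using hp)

theorem invOdds_eq_ofReal {p : ℝ} (hp : 0 < p) : invOdds p = ENNReal.ofReal ((1 - p) / p) := by
  rw [invOdds, ENNReal.ofReal_div_of_pos hp]

/-- The numerator `1 - p` is multiplied by exactly `1 - ρ`, while the denominator `p` can only grow.
-/
theorem invOdds_skipUpdate_le (hρ₀ : 0 < ρ) (hρ₁ : ρ < 1) {p : ℝ} (hp : p ∈ Set.Ico (0 : ℝ) 1) :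
    invOdds (skipUpdate ρ p) ≤ ENNReal.ofReal (1 - ρ) * invOdds p := by
  rcases hp.1.eq_or_lt with h | h
  · have : invOdds p = ∞ := by simp [invOdds, ← h]
    rw [this, ENNReal.mul_top (by simpa using hρ₁)]
    exact le_top
  · have hs := skipUpdate_mem hρ₀ hρ₁ hp
    rw [invOdds_eq_ofReal h, invOdds_eq_ofReal hs.1, ← ENNReal.ofReal_mul (by linarith)]
    apply ENNReal.ofReal_le_ofReal
    have h1 := hp.2
    rw [div_le_iff₀ hs.1, mul_div_assoc', div_mul_eq_mul_div, le_div_iff₀ h]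
    have : p ≤ skipUpdate ρ p := by unfold skipUpdate; nlinarith
    have e : 1 - skipUpdate ρ p = (1 - ρ) * (1 - p) := by unfold skipUpdate; ring
    rw [e]
    exact mul_le_mul_of_nonneg_left this (mul_nonneg (by linarith) (by linarith))

/-- A bound free of `p`, needed because `p` may be `0`, where the inverse odds are infinite and the
contraction says nothing. -/
theorem invOdds_skipUpdate_le_const (hρ₁ : ρ < 1) {p : ℝ}
    (hp : p ∈ Set.Ico (0 : ℝ) 1) : invOdds (skipUpdate ρ p) ≤ invOdds ρ := by
  refine invOdds_antitone ?_
  have := hp.1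
  unfold skipUpdate
  nlinarith

/-- Since `E_1[1 / L] ≤ 1`, taking an observation after the change does not increase the
expected inverse odds. -/
theorem lintegral_invOdds_takeUpdate_le (hf₀ : IsProbDensity μ f₀) (hf₁ : IsProbDensity μ f₁)
    (hL : ∀ᵐ x ∂μ, f₀ x = 0 → f₁ x = 0) (hρ₀ : 0 < ρ) (hρ₁ : ρ < 1) {p : ℝ}
    (hp : p ∈ Set.Ico (0 : ℝ) 1) :
    ∫⁻ y, invOdds (takeUpdate f₀ f₁ ρ y p) ∂law μ f₁ ≤ invOdds (skipUpdate ρ p) := by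
  obtain ⟨h0, h1⟩ := skipUpdate_mem hρ₀ hρ₁ hp
  have hm : Measurable fun y => invOdds (takeUpdate f₀ f₁ ρ y p) :=
    measurable_invOdds.comp ((measurable_takeUpdate hf₀.measurable hf₁.measurable).comp
      measurable_prodMk_left)
  rw [law, lintegral_withDensity_eq_lintegral_mul _ hf₁.measurable.ennreal_ofReal hm]
  calc _ ≤ ∫⁻ y, invOdds (skipUpdate ρ p) * ENNReal.ofReal (f₀ y) ∂μ := by
        refine lintegral_mono_ae ?_
        filter_upwards [hL] with y hy
        simp only [Pi.mul_apply]
        -- Where `f₁ = 0` the left side has weight zero. Elsewhere the odds are multiplied by `L`,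
        -- so `f₁ / L = f₀` turns the claim into an equality. Only an inequality survives
        -- integration, since `f₀` may charge `{f₁ = 0}`.
        rcases (hf₁.nonneg y).eq_or_lt with h | h
        · simp [← h]
        · have hf : 0 < f₀ y := (hf₀.nonneg y).lt_of_ne fun e => h.ne' (hy e.symm)
          have hl : 0 < likelihoodRatio f₀ f₁ y := div_pos h hf
          have hn : 0 < skipUpdate ρ p * likelihoodRatio f₀ f₁ y := mul_pos h0 hl
          have ht : 0 < takeUpdate f₀ f₁ ρ y p := div_pos hn (by linarith)
          rw [invOdds_eq_ofReal ht, invOdds_eq_ofReal h0, ← ENNReal.ofReal_mul h.le,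
            ← ENNReal.ofReal_mul (div_nonneg (by linarith) h0.le)]
          apply le_of_eq
          congr 1
          unfold takeUpdate
          have hd : skipUpdate ρ p * likelihoodRatio f₀ f₁ y + (1 - skipUpdate ρ p) ≠ 0 := by
            linarith
          rw [one_sub_div hd, add_sub_cancel_left, div_div_div_cancel_right₀ hd]
          unfold likelihoodRatio
          field_simp
    _ = invOdds (skipUpdate ρ p) := by
        rw [lintegral_const_mul _ hf₀.measurable.ennreal_ofReal, hf₀.lintegral_eq_one, mul_one]

theorem measurable_stepUpdate (hf₀ : Measurable f₀) (hf₁ : Measurable f₁) (B : ℝ) :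
    Measurable fun q : ℝ × E => stepUpdate f₀ f₁ ρ B q.2 q.1 :=
  Measurable.ite (measurableSet_le measurable_const measurable_fst)
    (measurable_takeUpdate hf₀ hf₁) (measurable_skipUpdate.comp measurable_fst)

/-- Skipping gives equality and observing gives at most the same value, so the inverse odds can be
controlled without knowing which action the policy takes. -/
theorem lintegral_invOdds_stepUpdate_le_skip (hf₀ : IsProbDensity μ f₀)
    (hf₁ : IsProbDensity μ f₁) (hL : ∀ᵐ x ∂μ, f₀ x = 0 → f₁ x = 0) (hρ₀ : 0 < ρ) (hρ₁ : ρ < 1)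
    (B : ℝ) {p : ℝ} (hp : p ∈ Set.Ico (0 : ℝ) 1) :
    ∫⁻ y, invOdds (stepUpdate f₀ f₁ ρ B y p) ∂law μ f₁ ≤ invOdds (skipUpdate ρ p) := by
  have := hf₁.isProbabilityMeasure_law
  unfold stepUpdate
  split_ifs
  · exact lintegral_invOdds_takeUpdate_le hf₀ hf₁ hL hρ₀ hρ₁ hp
  · simp

end QuickestChange

/-! ### The Shiryaev hitting time, supersolutions and subsolutions. -/

namespace QuickestChange

variable {E : Type*} [MeasurableSpace E] {μ : Measure E} {f₀ f₁ : E → ℝ} {ρ : ℝ}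

/-- The standing assumptions on the densities and on the parameter of the geometric prior. -/
structure Admissible (μ : Measure E) (f₀ f₁ : E → ℝ) (ρ : ℝ) : Prop where
  dens₀ : IsProbDensity μ f₀
  dens₁ : IsProbDensity μ f₁
  ac : ∀ᵐ x ∂μ, f₀ x = 0 → f₁ x = 0
  pos : 0 < ρ
  lt_one : ρ < 1

theorem Admissible.stepUpdate_mem (h : Admissible μ f₀ f₁ ρ) (B : ℝ) (x : E) {p : ℝ}
    (hp : p ∈ Set.Ico (0 : ℝ) 1) : stepUpdate f₀ f₁ ρ B x p ∈ Set.Ico (0 : ℝ) 1 :=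
  QuickestChange.stepUpdate_mem h.dens₀.nonneg h.dens₁.nonneg h.pos h.lt_one B x hp

theorem Admissible.takeUpdate_mem (h : Admissible μ f₀ f₁ ρ) (x : E) {p : ℝ}
    (hp : p ∈ Set.Ico (0 : ℝ) 1) : takeUpdate f₀ f₁ ρ x p ∈ Set.Ico (0 : ℝ) 1 :=
  QuickestChange.takeUpdate_mem h.dens₀.nonneg h.dens₁.nonneg h.pos h.lt_one x hp

theorem Admissible.lintegral_invOdds_stepUpdate_le (h : Admissible μ f₀ f₁ ρ) (B : ℝ) {p : ℝ}
    (hp : p ∈ Set.Ico (0 : ℝ) 1) :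
    ∫⁻ y, invOdds (stepUpdate f₀ f₁ ρ B y p) ∂law μ f₁ ≤
      ENNReal.ofReal (1 - ρ) * invOdds p :=
  (lintegral_invOdds_stepUpdate_le_skip h.dens₀ h.dens₁ h.ac h.pos h.lt_one B hp).trans
    (invOdds_skipUpdate_le h.pos h.lt_one hp)

theorem Admissible.lintegral_invOdds_stepUpdate_le_const (h : Admissible μ f₀ f₁ ρ) (B : ℝ)
    {p : ℝ} (hp : p ∈ Set.Ico (0 : ℝ) 1) :
    ∫⁻ y, invOdds (stepUpdate f₀ f₁ ρ B y p) ∂law μ f₁ ≤ invOdds ρ :=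
  (lintegral_invOdds_stepUpdate_le_skip h.dens₀ h.dens₁ h.ac h.pos h.lt_one B hp).trans
    (invOdds_skipUpdate_le_const h.lt_one hp)

theorem measurable_stepUpdate_left (h : Admissible μ f₀ f₁ ρ) (B p : ℝ) :
    Measurable fun y => stepUpdate f₀ f₁ ρ B y p :=
  (measurable_stepUpdate h.dens₀.measurable h.dens₁.measurable B).comp measurable_prodMk_left

theorem measurable_comp_stepUpdate (h : Admissible μ f₀ f₁ ρ) {g : ℝ → ℝ≥0∞} (hg : Measurable g)
    (B p : ℝ) : Measurable fun y => g (stepUpdate f₀ f₁ ρ B y p) :=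
  hg.comp (measurable_stepUpdate_left h B p)

/-- The expected number of steps, truncated at `n`, that the Shiryaev recursion started at `p`
needs to exceed `A` after the change (zero if `p` exceeds `A` already). -/
noncomputable def hitTimeApprox (μ : Measure E) (f₀ f₁ : E → ℝ) (ρ A : ℝ) : ℕ → ℝ → ℝ≥0∞
  | 0, _ => 0
  | n + 1, p =>
    if p ≤ A then 1 + ∫⁻ y, hitTimeApprox μ f₀ f₁ ρ A n (takeUpdate f₀ f₁ ρ y p) ∂law μ f₁ else 0

/-- The expected number of steps that the Shiryaev recursion started at `p` needs to exceed `A`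
after the change (zero if `p` exceeds `A` already). -/
noncomputable def hitTime (μ : Measure E) (f₀ f₁ : E → ℝ) (ρ A p : ℝ) : ℝ≥0∞ :=
  ⨆ n, hitTimeApprox μ f₀ f₁ ρ A n p

variable {A : ℝ}

theorem Admissible.measurable_hitTimeApprox (h : Admissible μ f₀ f₁ ρ) (n : ℕ) :
    Measurable (hitTimeApprox μ f₀ f₁ ρ A n) := by
  have := h.dens₁.isProbabilityMeasure_law
  induction n with
  | zero => exact measurable_const
  | succ n ih =>
    exact Measurable.ite measurableSet_Iic (measurable_const.add (Measurable.lintegral_prod_right'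
      (ih.comp (measurable_takeUpdate h.dens₀.measurable h.dens₁.measurable)))) measurable_const

theorem Admissible.measurable_hitTime (h : Admissible μ f₀ f₁ ρ) :
    Measurable (hitTime μ f₀ f₁ ρ A) :=
  Measurable.iSup fun n => h.measurable_hitTimeApprox n

theorem hitTimeApprox_mono : Monotone (hitTimeApprox μ f₀ f₁ ρ A) := by
  refine monotone_nat_of_le_succ fun n => ?_
  induction n with
  | zero => exact fun p => zero_le
  | succ n ih =>
    intro p
    simp only [hitTimeApprox]
    split_ifs
    · gcongr
      exact ih _
    · exact le_rfl

/-- Monotone coupling: fed with the same observations, the recursion started higher stays higher, as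
`takeUpdate` is monotone in the posterior. -/
theorem hitTimeApprox_antitoneOn (h : Admissible μ f₀ f₁ ρ) (n : ℕ) :
    AntitoneOn (hitTimeApprox μ f₀ f₁ ρ A n) (Set.Ico 0 1) := by
  induction n with
  | zero => exact fun p _ q _ _ => le_rfl
  | succ n ih =>
    intro p hp q hq hpq
    simp only [hitTimeApprox]
    by_cases hA : q ≤ A
    · rw [if_pos hA, if_pos (hpq.trans hA)]
      gcongr with y
      exact ih (h.takeUpdate_mem y hp) (h.takeUpdate_mem y hq)
        (takeUpdate_mono h.dens₀.nonneg h.dens₁.nonneg h.pos h.lt_one y hp hq hpq)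
    · rw [if_neg hA]
      exact zero_le

theorem hitTime_antitoneOn (h : Admissible μ f₀ f₁ ρ) :
    AntitoneOn (hitTime μ f₀ f₁ ρ A) (Set.Ico 0 1) := fun _ hp _ hq hpq =>
  iSup_mono fun n => hitTimeApprox_antitoneOn h n hp hq hpq

theorem hitTime_of_lt {p : ℝ} (hp : A < p) : hitTime μ f₀ f₁ ρ A p = 0 := by
  refine le_antisymm (iSup_le fun n => ?_) zero_le
  cases n with
  | zero => exact le_rfl
  | succ n => simp [hitTimeApprox, hp.not_ge]

/-- First step analysis for the expected hitting time. -/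
theorem hitTime_eq (h : Admissible μ f₀ f₁ ρ) {p : ℝ} (hp : p ≤ A) :
    hitTime μ f₀ f₁ ρ A p =
      1 + ∫⁻ y, hitTime μ f₀ f₁ ρ A (takeUpdate f₀ f₁ ρ y p) ∂law μ f₁ := by
  have hsup : hitTime μ f₀ f₁ ρ A p = ⨆ n, hitTimeApprox μ f₀ f₁ ρ A (n + 1) p :=
    (Monotone.iSup_nat_add (f := fun n => hitTimeApprox μ f₀ f₁ ρ A n p)
      (fun m n hmn => hitTimeApprox_mono hmn p) 1).symm
  rw [hsup]
  simp only [hitTimeApprox, if_pos hp]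
  rw [← ENNReal.add_iSup]
  congr 1
  unfold hitTime
  rw [lintegral_iSup]
  · exact fun n => (h.measurable_hitTimeApprox n).comp ((measurable_takeUpdate
      h.dens₀.measurable h.dens₁.measurable).comp measurable_prodMk_left)
  · exact fun m n hmn y => hitTimeApprox_mono hmn _

/-- The expected hitting time is the smallest supersolution of its first step equation. -/
theorem hitTime_le_of_supersolution (h : Admissible μ f₀ f₁ ρ) {g : ℝ → ℝ≥0∞}
    (hg : ∀ p ∈ Set.Ico (0 : ℝ) 1, p ≤ A →
      1 + ∫⁻ y, g (takeUpdate f₀ f₁ ρ y p) ∂law μ f₁ ≤ g p)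
    {p : ℝ} (hp : p ∈ Set.Ico (0 : ℝ) 1) : hitTime μ f₀ f₁ ρ A p ≤ g p := by
  refine iSup_le fun n => ?_
  induction n generalizing p with
  | zero => exact zero_le
  | succ n ih =>
    simp only [hitTimeApprox]
    split_ifs with hA
    · refine le_trans ?_ (hg p hp hA)
      gcongr with y
      exact ih (h.takeUpdate_mem y hp)
    · exact zero_le

/-- The constant in front of the inverse odds in the supersolutions for the level `s`. -/
noncomputable def oddsConst (ρ s : ℝ) : ℝ≥0∞ := (ENNReal.ofReal ρ * invOdds s)⁻¹

theorem oddsConst_ne_top (h : Admissible μ f₀ f₁ ρ) {s : ℝ} (hs : s < 1) :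
    oddsConst ρ s ≠ ∞ := by
  rw [oddsConst, Ne, ENNReal.inv_eq_top, mul_eq_zero]
  simp [invOdds_pos hs, h.pos]

/-- The constant is chosen so that the loss of the fraction `ρ` of `oddsConst ρ s * invOdds p` is
exactly `1` at `p = s`. Below `s` the inverse odds, and hence the loss, are larger. -/
theorem one_add_oddsConst_mul_le (h : Admissible μ f₀ f₁ ρ) {s p : ℝ}
    (hs : s ∈ Set.Ioo (0 : ℝ) 1) (hps : p ≤ s) :
    1 + oddsConst ρ s * (ENNReal.ofReal (1 - ρ) * invOdds p) ≤ oddsConst ρ s * invOdds p := by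
  have hsplit : invOdds p =
      ENNReal.ofReal ρ * invOdds p + ENNReal.ofReal (1 - ρ) * invOdds p := by
    rw [← add_mul, ← ENNReal.ofReal_add h.pos.le (by linarith [h.lt_one])]
    simp
  have hone : 1 ≤ oddsConst ρ s * (ENNReal.ofReal ρ * invOdds p) := by
    calc (1 : ℝ≥0∞) = oddsConst ρ s * (ENNReal.ofReal ρ * invOdds s) := by
          rw [oddsConst, ENNReal.inv_mul_cancel]
          · simp [invOdds_pos hs.2, h.pos]
          · exact ENNReal.mul_ne_top ENNReal.ofReal_ne_top (invOdds_ne_top hs.1)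
      _ ≤ _ := by gcongr; exact invOdds_antitone hps
  conv_rhs => rw [hsplit, mul_add]
  gcongr

/-- A supersolution for the two-threshold recursion, from the expected Shiryaev hitting time. -/
noncomputable def superSol (μ : Measure E) (f₀ f₁ : E → ℝ) (ρ A s p : ℝ) : ℝ≥0∞ :=
  hitTime μ f₀ f₁ ρ A (max p s) + oddsConst ρ s * invOdds p

theorem Admissible.measurable_superSol (h : Admissible μ f₀ f₁ ρ) (s : ℝ) :
    Measurable (superSol μ f₀ f₁ ρ A s) :=
  (h.measurable_hitTime.comp (measurable_id.max measurable_const)).add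
    (measurable_invOdds.const_mul _)

theorem one_add_lintegral_superSol_le (h : Admissible μ f₀ f₁ ρ) {B s : ℝ}
    (hs : s ∈ Set.Ioo (0 : ℝ) 1) (hBs : B ≤ s) {p : ℝ} (hp : p ∈ Set.Ico (0 : ℝ) 1) (hpA : p ≤ A) :
    1 + ∫⁻ y, superSol μ f₀ f₁ ρ A s (stepUpdate f₀ f₁ ρ B y p) ∂law μ f₁ ≤
      superSol μ f₀ f₁ ρ A s p := by
  have := h.dens₁.isProbabilityMeasure_law
  have hmem : ∀ {q}, q ∈ Set.Ico (0 : ℝ) 1 → max q s ∈ Set.Ico (0 : ℝ) 1 := fun hq =>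
    ⟨hs.1.le.trans (le_max_right _ _), max_lt hq.2 hs.2⟩
  have hint : ∫⁻ y, superSol μ f₀ f₁ ρ A s (stepUpdate f₀ f₁ ρ B y p) ∂law μ f₁ ≤
      (∫⁻ y, hitTime μ f₀ f₁ ρ A (max (stepUpdate f₀ f₁ ρ B y p) s) ∂law μ f₁) +
        oddsConst ρ s * (ENNReal.ofReal (1 - ρ) * invOdds p) := by
    have hm₁ : Measurable fun y =>
        hitTime μ f₀ f₁ ρ A (max (stepUpdate f₀ f₁ ρ B y p) s) :=
      h.measurable_hitTime.comp ((measurable_stepUpdate_left h B p).max measurable_const)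
    have hm₂ : Measurable fun y => invOdds (stepUpdate f₀ f₁ ρ B y p) :=
      measurable_invOdds.comp (measurable_stepUpdate_left h B p)
    unfold superSol
    rw [lintegral_add_left hm₁, lintegral_const_mul _ hm₂]
    gcongr
    exact h.lintegral_invOdds_stepUpdate_le B hp
  refine (add_le_add_right hint 1).trans ?_
  rcases lt_or_ge p s with hps | hps
  -- Below `s` the hitting time term is at its maximal value `hitTime` at `s` and cannot increase,
  -- and the contraction of the inverse odds pays for the step.
  · have hv : ∫⁻ y, hitTime μ f₀ f₁ ρ A (max (stepUpdate f₀ f₁ ρ B y p) s) ∂law μ f₁ ≤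
        hitTime μ f₀ f₁ ρ A s := by
      calc _ ≤ ∫⁻ _, hitTime μ f₀ f₁ ρ A s ∂law μ f₁ := by
            refine lintegral_mono fun y => ?_
            exact hitTime_antitoneOn h (Set.Ioo_subset_Ico_self hs)
              (hmem (h.stepUpdate_mem B y hp)) (le_max_right _ _)
        _ = _ := by simp
    rw [superSol, max_eq_right hps.le, add_left_comm]
    exact add_le_add hv (one_add_oddsConst_mul_le h hs hps.le)
  -- Above `s ≥ B` the observation is taken, so the first step equation of `hitTime` pays for the
  -- step. The maximum with `s` only lowers `hitTime`, and the inverse odds do not increase in mean.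
  · rw [superSol, max_eq_left hps, hitTime_eq h hpA, ← add_assoc]
    have hBp : B ≤ p := hBs.trans hps
    simp only [stepUpdate, if_pos hBp]
    gcongr with y
    · exact hitTime_antitoneOn h (h.takeUpdate_mem y hp) (hmem (h.takeUpdate_mem y hp))
        (le_max_left _ _)
    · calc _ ≤ 1 * invOdds p := by
            gcongr
            rw [ENNReal.ofReal_le_one]
            linarith [h.pos]
        _ = _ := one_mul _

/-- With threshold `0` the policy is the Shiryaev recursion, so `superSol` also dominates its own
hitting time. -/
theorem hitTime_le_superSol (h : Admissible μ f₀ f₁ ρ) {s p : ℝ}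
    (hs : s ∈ Set.Ioo (0 : ℝ) 1) (hp : p ∈ Set.Ico (0 : ℝ) 1) :
    hitTime μ f₀ f₁ ρ A p ≤ superSol μ f₀ f₁ ρ A s p := by
  refine hitTime_le_of_supersolution h (fun q hq hqA => ?_) hp
  have := one_add_lintegral_superSol_le h hs hs.1.le hq hqA (B := 0)
  simpa only [stepUpdate_zero _ hq.1] using this

/-- Starting below the level `s` costs at most a multiple of the inverse odds. -/
theorem hitTime_le_hitTime_add (h : Admissible μ f₀ f₁ ρ) {s p : ℝ}
    (hs : s ∈ Set.Ioo (0 : ℝ) 1) (hp : p ∈ Set.Ico (0 : ℝ) 1) :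
    hitTime μ f₀ f₁ ρ A p ≤ hitTime μ f₀ f₁ ρ A s + oddsConst ρ s * invOdds p := by
  refine (hitTime_le_superSol h hs hp).trans ?_
  unfold superSol
  gcongr
  exact hitTime_antitoneOn h (Set.Ioo_subset_Ico_self hs)
    ⟨hs.1.le.trans (le_max_right _ _), max_lt hp.2 hs.2⟩ (le_max_right _ _)

theorem exists_hitTime_le (h : Admissible μ f₀ f₁ ρ) (hA : A < 1) :
    ∃ C : ℝ≥0∞, C ≠ ∞ ∧ ∀ p ∈ Set.Ico (0 : ℝ) 1, hitTime μ f₀ f₁ ρ A p ≤ C * invOdds p := by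
  -- A level `s > A` has hitting time zero, which leaves only the inverse odds term.
  obtain ⟨s, hs, hs1⟩ := exists_between (max_lt hA one_pos)
  have hs0 := (le_max_right A 0).trans_lt hs
  refine ⟨oddsConst ρ s, oddsConst_ne_top h hs1, fun p hp => ?_⟩
  have := hitTime_le_hitTime_add h ⟨hs0, hs1⟩ hp (A := A)
  rwa [hitTime_of_lt ((le_max_left A 0).trans_lt hs), zero_add] at this

/-- A subsolution inequality for the two-threshold recursion: an excursion below `B` costs at
most a multiple of the inverse odds. -/
theorem hitTime_le_stepUpdate (h : Admissible μ f₀ f₁ ρ) {B p : ℝ}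
    (hp : p ∈ Set.Ico (0 : ℝ) 1) :
    hitTime μ f₀ f₁ ρ A p ≤ 1 + (oddsConst ρ (skipUpdate ρ B) * invOdds p +
      ∫⁻ y, hitTime μ f₀ f₁ ρ A (stepUpdate f₀ f₁ ρ B y p) ∂law μ f₁) := by
  have := h.dens₁.isProbabilityMeasure_law
  rcases lt_or_ge A p with hpA | hpA
  · rw [hitTime_of_lt hpA]
    exact zero_le
  by_cases hBp : B ≤ p
  · rw [hitTime_eq h hpA]
    simp only [stepUpdate, if_pos hBp]
    gcongr
    exact le_add_self
  -- A skip moves `p` to `skipUpdate ρ p`, which serves as the comparison level. It is at most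
  -- `skipUpdate ρ B`, and `oddsConst` is monotone in the level, so the constant is uniform over `p
  -- < B`.
  · simp only [stepUpdate, if_neg hBp]
    rw [lintegral_const, measure_univ, mul_one]
    have hs := QuickestChange.skipUpdate_mem h.pos h.lt_one hp
    refine (hitTime_le_hitTime_add h hs hp).trans ?_
    rw [add_comm]
    refine le_trans ?_ le_add_self
    gcongr
    unfold oddsConst
    gcongr
    exact invOdds_antitone (skipUpdate_mono h.lt_one (not_le.1 hBp).le)

end QuickestChange

/-! ### Survival indicators and their dependence on the path. -/

namespace QuickestChange

theorem natCast_lt_firstAbove {u : ℕ → ℝ} {A : ℝ} {k : ℕ} :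
    (k : ℕ∞) < firstAbove u A ↔ ∀ i, 1 ≤ i → i ≤ k → u i ≤ A := by
  constructor
  · intro hk i hi hik
    by_contra hA
    have : firstAbove u A ≤ i := iInf₂_le i ⟨hi, not_le.1 hA⟩
    exact absurd (hk.trans_le this) (by exact_mod_cast hik.not_gt)
  · intro hk
    refine (ENat.natCast_lt_succ).trans_le (le_iInf₂ fun i hi => ?_)
    have : k < i := by
      by_contra hik
      exact (hk i hi.1 (not_lt.1 hik)).not_gt hi.2
    exact_mod_cast this

open Classical in
/-- The indicator of `k < inf {i ≥ 1 : u_i > A}`. -/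
noncomputable def survival (u : ℕ → ℝ) (A : ℝ) (k : ℕ) : ℝ≥0∞ :=
  if (k : ℕ∞) < firstAbove u A then 1 else 0

theorem survival_le_one (u : ℕ → ℝ) (A : ℝ) (k : ℕ) : survival u A k ≤ 1 := by
  unfold survival
  split_ifs <;> simp

/-- The hitting time ignores index `0`, so time `0` is survived even when `u 0 > A`. -/
theorem survival_zero (u : ℕ → ℝ) (A : ℝ) : survival u A 0 = 1 := by
  rw [survival, if_pos]
  rw [natCast_lt_firstAbove]
  omega

theorem survival_succ (u : ℕ → ℝ) (A : ℝ) (k : ℕ) :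
    survival u A (k + 1) = survival u A k * (if u (k + 1) ≤ A then 1 else 0) := by
  unfold survival
  simp only [natCast_lt_firstAbove]
  by_cases hk : ∀ i, 1 ≤ i → i ≤ k → u i ≤ A
  · by_cases hu : u (k + 1) ≤ A
    · rw [if_pos, if_pos hk, if_pos hu, mul_one]
      intro i hi hik
      rcases Nat.le_succ_iff.1 hik with h | h
      · exact hk i hi h
      · rwa [h]
    · rw [if_neg, if_neg hu, mul_zero]
      exact fun h => hu (h _ (by omega) le_rfl)
  · rw [if_neg, if_neg hk, zero_mul]
    exact fun h => hk fun i hi hik => h i hi (by omega)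

theorem survival_eq_zero_of_lt {u : ℕ → ℝ} {A : ℝ} {k : ℕ} (hk : 1 ≤ k) (hA : A < u k) :
    survival u A k = 0 := by
  obtain ⟨j, rfl⟩ := Nat.exists_eq_add_of_le' hk
  rw [survival_succ, if_neg hA.not_ge, mul_zero]

/-- A hitting time counts its strict lower bounds. -/
theorem tsum_survival (u : ℕ → ℝ) (A : ℝ) (m : ℕ) :
    ∑' j, survival u A (m + j) = (firstAbove u A : ℝ≥0∞) - m := by
  unfold survival
  generalize firstAbove u A = N
  induction N using ENat.recTopCoe with
  | top => simp
  | coe n =>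
    rw [tsum_eq_sum (s := Finset.range (n - m))]
    · rw [Finset.sum_congr rfl fun j hj => if_pos ?_]
      · simp
      · rw [Finset.mem_range] at hj
        exact_mod_cast (by omega : m + j < n)
    · intro j hj
      rw [Finset.mem_range] at hj
      rw [if_neg]
      exact_mod_cast (by omega : ¬ m + j < n)

section Path

variable {E : Type*} {f₀ f₁ : E → ℝ} {ρ p B A : ℝ}

theorem post_succ (x : ℕ → E) (k : ℕ) :
    post f₀ f₁ ρ p B x (k + 1) = stepUpdate f₀ f₁ ρ B (x (k + 1)) (post f₀ f₁ ρ p B x k) := rfl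

theorem post_update (x : ℕ → E) (y : E) {i k : ℕ} (hik : k < i) :
    post f₀ f₁ ρ p B (Function.update x i y) k = post f₀ f₁ ρ p B x k := by
  induction k with
  | zero => rfl
  | succ k ih =>
    rw [post_succ, post_succ, ih (by omega), Function.update_of_ne (by omega)]

theorem survival_post_update (x : ℕ → E) (y : E) {i k : ℕ} (hik : k < i) :
    survival (post f₀ f₁ ρ p B (Function.update x i y)) A k =
      survival (post f₀ f₁ ρ p B x) A k := by
  induction k with
  | zero => rw [survival_zero, survival_zero]
  | succ k ih => rw [survival_succ, survival_succ, ih (by omega), post_update x y hik]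

theorem post_mem (h₀ : ∀ x, 0 ≤ f₀ x) (h₁ : ∀ x, 0 ≤ f₁ x) (hρ₀ : 0 < ρ) (hρ₁ : ρ < 1)
    (hp : p ∈ Set.Ico (0 : ℝ) 1) (x : ℕ → E) (k : ℕ) :
    post f₀ f₁ ρ p B x k ∈ Set.Ico (0 : ℝ) 1 := by
  induction k with
  | zero => exact hp
  | succ k ih =>
    rw [post_succ]
    exact stepUpdate_mem h₀ h₁ hρ₀ hρ₁ B _ ih

/-- Posteriors are nonnegative, so threshold `0` never skips. Results on the two-threshold recursion
thereby cover the Shiryaev recursion too. -/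
theorem shiryaev_eq_post (h₀ : ∀ x, 0 ≤ f₀ x) (h₁ : ∀ x, 0 ≤ f₁ x) (hρ₀ : 0 < ρ) (hρ₁ : ρ < 1)
    (hp : p ∈ Set.Ico (0 : ℝ) 1) (x : ℕ → E) :
    shiryaev f₀ f₁ ρ p x = post f₀ f₁ ρ p 0 x := by
  funext k
  induction k with
  | zero => rfl
  | succ k ih =>
    rw [post_succ, ← ih, stepUpdate_zero, shiryaev]
    rw [ih]
    exact (post_mem h₀ h₁ hρ₀ hρ₁ hp x k).1

variable [MeasurableSpace E]

theorem measurable_post (hf₀ : Measurable f₀) (hf₁ : Measurable f₁) (k : ℕ) :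
    Measurable fun x : ℕ → E => post f₀ f₁ ρ p B x k := by
  induction k with
  | zero => exact measurable_const
  | succ k ih =>
    exact (measurable_stepUpdate hf₀ hf₁ B).comp (ih.prodMk (measurable_pi_apply (k + 1)))

theorem measurable_survival (hf₀ : Measurable f₀) (hf₁ : Measurable f₁) (k : ℕ) :
    Measurable fun x : ℕ → E => survival (post f₀ f₁ ρ p B x) A k := by
  induction k with
  | zero =>
    simp only [survival_zero]
    exact measurable_const
  | succ k ih =>
    simp only [survival_succ]
    exact ih.mul (Measurable.ite
      (measurableSet_le (measurable_post hf₀ hf₁ (k + 1)) measurable_const)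
      measurable_const measurable_const)

end Path

/-! ### Expected time to alarm for a fixed change point. -/

section Law

variable {E : Type*} [MeasurableSpace E] {μ : Measure E} {f₀ f₁ : E → ℝ} {ρ p B A : ℝ}

theorem Admissible.post_mem (h : Admissible μ f₀ f₁ ρ) (hp : p ∈ Set.Ico (0 : ℝ) 1) (x : ℕ → E)
    (k : ℕ) : post f₀ f₁ ρ p B x k ∈ Set.Ico (0 : ℝ) 1 :=
  QuickestChange.post_mem h.dens₀.nonneg h.dens₁.nonneg h.pos h.lt_one hp x k

theorem Admissible.measurable_post (h : Admissible μ f₀ f₁ ρ) (k : ℕ) :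
    Measurable fun x : ℕ → E => post f₀ f₁ ρ p B x k :=
  QuickestChange.measurable_post h.dens₀.measurable h.dens₁.measurable k

theorem Admissible.measurable_comp_post (h : Admissible μ f₀ f₁ ρ) {g : ℝ → ℝ≥0∞}
    (hg : Measurable g) (k : ℕ) : Measurable fun x : ℕ → E => g (post f₀ f₁ ρ p B x k) :=
  hg.comp (h.measurable_post k)

theorem Admissible.measurable_survival (h : Admissible μ f₀ f₁ ρ) (k : ℕ) :
    Measurable fun x : ℕ → E => survival (post f₀ f₁ ρ p B x) A k :=
  QuickestChange.measurable_survival h.dens₀.measurable h.dens₁.measurable k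

theorem Admissible.isProbabilityMeasure_changeAt (h : Admissible μ f₀ f₁ ρ) (ℓ : ℕ) :
    IsProbabilityMeasure (changeAt μ f₀ f₁ ℓ) := by
  have (k : ℕ) : IsProbabilityMeasure (if k < ℓ then law μ f₀ else law μ f₁) := by
    split_ifs
    exacts [h.dens₀.isProbabilityMeasure_law, h.dens₁.isProbabilityMeasure_law]
  rw [changeAt]
  infer_instance

/-- The Markov property after the change. -/
theorem lintegral_mul_post_succ (h : Admissible μ f₀ f₁ ρ) {ℓ k : ℕ} (hk : ℓ ≤ k + 1)
    {G : (ℕ → E) → ℝ≥0∞} (hG : Measurable G)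
    (hGu : ∀ x y, G (Function.update x (k + 1) y) = G x) {g : ℝ → ℝ≥0∞} (hg : Measurable g) :
    ∫⁻ x, G x * g (post f₀ f₁ ρ p B x (k + 1)) ∂changeAt μ f₀ f₁ ℓ =
      ∫⁻ x, G x * ∫⁻ y, g (stepUpdate f₀ f₁ ρ B y (post f₀ f₁ ρ p B x k)) ∂law μ f₁
        ∂changeAt μ f₀ f₁ ℓ := by
  have (k : ℕ) : IsProbabilityMeasure (if k < ℓ then law μ f₀ else law μ f₁) := by
    split_ifs
    exacts [h.dens₀.isProbabilityMeasure_law, h.dens₁.isProbabilityMeasure_law]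
  have hm : Measurable fun x => G x * g (post f₀ f₁ ρ p B x (k + 1)) :=
    hG.mul (h.measurable_comp_post hg (k + 1))
  -- Resampling coordinate `k + 1` replaces it by an independent draw from `f₁`, because `ℓ ≤ k +
  -- 1`. The posterior at time `k` does not see this coordinate.
  rw [changeAt, Measure.lintegral_infinitePi_update _ (k + 1) hm]
  refine lintegral_congr fun x => ?_
  simp only [hGu]
  rw [if_neg hk.not_gt, ← lintegral_const_mul _ (measurable_comp_stepUpdate h hg B _)]
  refine lintegral_congr fun y => ?_
  rw [post_succ, post_update _ _ (Nat.lt_succ_self k), Function.update_self]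

/-- The first step under `f₁` forgets the past: it brings the mean inverse odds below `invOdds ρ`
whatever the posterior was. Every later step contracts them by `1 - ρ`. -/
theorem lintegral_invOdds_post_succ_le (h : Admissible μ f₀ f₁ ρ) (hp : p ∈ Set.Ico (0 : ℝ) 1)
    {ℓ m : ℕ} (hm : ℓ ≤ m + 1) (j : ℕ) :
    ∫⁻ x, invOdds (post f₀ f₁ ρ p B x (m + 1 + j)) ∂changeAt μ f₀ f₁ ℓ ≤
      ENNReal.ofReal (1 - ρ) ^ j * invOdds ρ := by
  have := h.isProbabilityMeasure_changeAt ℓ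
  have hstep (k : ℕ) (hk : ℓ ≤ k + 1) :
      ∫⁻ x, invOdds (post f₀ f₁ ρ p B x (k + 1)) ∂changeAt μ f₀ f₁ ℓ =
        ∫⁻ x, ∫⁻ y, invOdds (stepUpdate f₀ f₁ ρ B y (post f₀ f₁ ρ p B x k)) ∂law μ f₁
          ∂changeAt μ f₀ f₁ ℓ := by
    simpa using lintegral_mul_post_succ h hk (G := fun _ => 1) measurable_const
      (fun _ _ => rfl) measurable_invOdds (p := p) (B := B)
  induction j with
  | zero =>
    rw [pow_zero, one_mul, add_zero, hstep m hm]
    calc _ ≤ ∫⁻ _, invOdds ρ ∂changeAt μ f₀ f₁ ℓ := lintegral_mono fun x =>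
          h.lintegral_invOdds_stepUpdate_le_const B (h.post_mem hp x m)
      _ = _ := by simp
  | succ j ih =>
    rw [← add_assoc, hstep _ (by omega), pow_succ', mul_assoc]
    refine le_trans ?_ (mul_le_mul_right ih _)
    rw [← lintegral_const_mul _ (h.measurable_comp_post measurable_invOdds _)]
    exact lintegral_mono fun x => h.lintegral_invOdds_stepUpdate_le B (h.post_mem hp x _)

theorem geometric_ne_top (h : Admissible μ f₀ f₁ ρ) : (1 - ENNReal.ofReal (1 - ρ))⁻¹ ≠ ∞ := by
  rw [Ne, ENNReal.inv_eq_top, tsub_eq_zero_iff_le, ENNReal.one_le_ofReal]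
  linarith [h.pos]

/-- The total expected inverse odds after the change. -/
noncomputable def oddsBound (ρ : ℝ) : ℝ≥0∞ := (1 - ENNReal.ofReal (1 - ρ))⁻¹ * invOdds ρ

theorem oddsBound_ne_top (h : Admissible μ f₀ f₁ ρ) : oddsBound ρ ≠ ∞ :=
  ENNReal.mul_ne_top (geometric_ne_top h) (invOdds_ne_top h.pos)

theorem tsum_lintegral_invOdds_post_le (h : Admissible μ f₀ f₁ ρ) (hp : p ∈ Set.Ico (0 : ℝ) 1)
    {ℓ m : ℕ} (hm : ℓ ≤ m + 1) :
    ∑' j, ∫⁻ x, invOdds (post f₀ f₁ ρ p B x (m + 1 + j)) ∂changeAt μ f₀ f₁ ℓ ≤ oddsBound ρ := by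
  refine (ENNReal.tsum_le_tsum fun j => lintegral_invOdds_post_succ_le h hp hm j).trans ?_
  rw [ENNReal.tsum_mul_right, ENNReal.tsum_geometric, oddsBound]

/-- A supersolution bounds the expected time to alarm of the two-threshold policy. -/
theorem tsum_lintegral_survival_le (h : Admissible μ f₀ f₁ ρ) (hp : p ∈ Set.Ico (0 : ℝ) 1)
    {ℓ m : ℕ} (hm : ℓ ≤ m + 1) (hstart : 1 ≤ m ∨ p ≤ A) {g : ℝ → ℝ≥0∞} (hg : Measurable g)
    (hsup : ∀ q ∈ Set.Ico (0 : ℝ) 1, q ≤ A →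
      1 + ∫⁻ y, g (stepUpdate f₀ f₁ ρ B y q) ∂law μ f₁ ≤ g q) :
    ∑' j, ∫⁻ x, survival (post f₀ f₁ ρ p B x) A (m + j) ∂changeAt μ f₀ f₁ ℓ ≤
      ∫⁻ x, survival (post f₀ f₁ ρ p B x) A m * g (post f₀ f₁ ρ p B x m)
        ∂changeAt μ f₀ f₁ ℓ := by
  have hstep (k : ℕ) (hk : m ≤ k) :
      (∫⁻ x, survival (post f₀ f₁ ρ p B x) A k ∂changeAt μ f₀ f₁ ℓ) +
        ∫⁻ x, survival (post f₀ f₁ ρ p B x) A (k + 1) * g (post f₀ f₁ ρ p B x (k + 1))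
          ∂changeAt μ f₀ f₁ ℓ ≤
      ∫⁻ x, survival (post f₀ f₁ ρ p B x) A k * g (post f₀ f₁ ρ p B x k)
        ∂changeAt μ f₀ f₁ ℓ := by
    have h1 : ∫⁻ x, survival (post f₀ f₁ ρ p B x) A (k + 1) * g (post f₀ f₁ ρ p B x (k + 1))
          ∂changeAt μ f₀ f₁ ℓ ≤
        ∫⁻ x, survival (post f₀ f₁ ρ p B x) A k *
          ∫⁻ y, g (stepUpdate f₀ f₁ ρ B y (post f₀ f₁ ρ p B x k)) ∂law μ f₁
            ∂changeAt μ f₀ f₁ ℓ := by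
      rw [← lintegral_mul_post_succ h (by omega) (h.measurable_survival k)
        (fun x y => survival_post_update x y (Nat.lt_succ_self k)) hg]
      refine lintegral_mono fun x => mul_le_mul_left ?_ _
      rw [survival_succ]
      split_ifs <;> simp
    refine (add_le_add_right h1 _).trans ?_
    rw [← lintegral_add_left (h.measurable_survival k)]
    refine lintegral_mono fun x => ?_
    rcases le_or_gt (post f₀ f₁ ρ p B x k) A with hA | hA
    · refine le_trans (le_of_eq ?_) (mul_le_mul_right (hsup _ (h.post_mem hp x k) hA) _)
      rw [mul_add, mul_one]
    -- Survival does not exclude a posterior above `A` at time `0`, where the supersolution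
    -- inequality is not available. This is the case that `hstart` rules out.
    · have hk1 : 1 ≤ k := by
        rcases hstart with h' | h'
        · omega
        · by_contra hk0
          obtain rfl : k = 0 := by omega
          exact absurd hA (not_lt.2 h')
      simp [survival_eq_zero_of_lt hk1 hA]
  have hfin (n : ℕ) :
      (∑ j ∈ Finset.range n, ∫⁻ x, survival (post f₀ f₁ ρ p B x) A (m + j) ∂changeAt μ f₀ f₁ ℓ) +
        ∫⁻ x, survival (post f₀ f₁ ρ p B x) A (m + n) * g (post f₀ f₁ ρ p B x (m + n))
          ∂changeAt μ f₀ f₁ ℓ ≤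
      ∫⁻ x, survival (post f₀ f₁ ρ p B x) A m * g (post f₀ f₁ ρ p B x m)
        ∂changeAt μ f₀ f₁ ℓ := by
    induction n with
    | zero => simp
    | succ n ih =>
      refine le_trans ?_ ih
      rw [Finset.sum_range_succ, add_assoc]
      gcongr
      exact hstep (m + n) (by omega)
  rw [ENNReal.tsum_eq_iSup_nat]
  exact iSup_le fun n => le_self_add.trans (hfin n)

/-- The expected Shiryaev hitting time bounds from below, up to the expected total inverse
odds, the expected time to alarm of the two-threshold policy. -/
theorem lintegral_survival_mul_hitTime_le (h : Admissible μ f₀ f₁ ρ) (hA : A < 1)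
    (hp : p ∈ Set.Ico (0 : ℝ) 1) {ℓ m : ℕ} (hm : ℓ ≤ m + 1) {K : ℝ≥0∞}
    (hK : ∀ q ∈ Set.Ico (0 : ℝ) 1, hitTime μ f₀ f₁ ρ A q ≤ 1 + (K * invOdds q +
      ∫⁻ y, hitTime μ f₀ f₁ ρ A (stepUpdate f₀ f₁ ρ B y q) ∂law μ f₁)) :
    ∫⁻ x, survival (post f₀ f₁ ρ p B x) A m * hitTime μ f₀ f₁ ρ A (post f₀ f₁ ρ p B x m)
        ∂changeAt μ f₀ f₁ ℓ ≤
      (∑' j, ∫⁻ x, survival (post f₀ f₁ ρ p B x) A (m + j) ∂changeAt μ f₀ f₁ ℓ) +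
        K * ∑' j, ∫⁻ x, invOdds (post f₀ f₁ ρ p B x (m + j)) ∂changeAt μ f₀ f₁ ℓ := by
  set R : ℕ → ℝ≥0∞ := fun k =>
    ∫⁻ x, survival (post f₀ f₁ ρ p B x) A k * hitTime μ f₀ f₁ ρ A (post f₀ f₁ ρ p B x k)
        ∂changeAt μ f₀ f₁ ℓ with hR
  set S : ℕ → ℝ≥0∞ := fun k =>
    ∫⁻ x, survival (post f₀ f₁ ρ p B x) A k ∂changeAt μ f₀ f₁ ℓ with hS
  set O : ℕ → ℝ≥0∞ := fun k =>
    ∫⁻ x, invOdds (post f₀ f₁ ρ p B x k) ∂changeAt μ f₀ f₁ ℓ with hO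
  have hstep (k : ℕ) (hk : m ≤ k) : R k ≤ S k + K * O k + R (k + 1) := by
    have h1 : R (k + 1) = ∫⁻ x, survival (post f₀ f₁ ρ p B x) A k *
          ∫⁻ y, hitTime μ f₀ f₁ ρ A (stepUpdate f₀ f₁ ρ B y (post f₀ f₁ ρ p B x k)) ∂law μ f₁
            ∂changeAt μ f₀ f₁ ℓ := by
      rw [← lintegral_mul_post_succ h (by omega) (h.measurable_survival k)
        (fun x y => survival_post_update x y (Nat.lt_succ_self k)) h.measurable_hitTime]
      -- The additional factor of survival at time `k + 1` is harmless: where it vanishes, so does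
      -- `hitTime`.
      refine lintegral_congr fun x => ?_
      rw [survival_succ]
      split_ifs with hu
      · rw [mul_one]
      · rw [hitTime_of_lt (not_le.1 hu), mul_zero, mul_zero]
    have hmO : Measurable fun x =>
        survival (post f₀ f₁ ρ p B x) A k + K * invOdds (post f₀ f₁ ρ p B x k) :=
      (h.measurable_survival k).add ((h.measurable_comp_post measurable_invOdds k).const_mul K)
    rw [h1]
    simp only [hS, hO]
    rw [← lintegral_const_mul _ (h.measurable_comp_post measurable_invOdds k),
      ← lintegral_add_left (h.measurable_survival k),
      ← lintegral_add_left hmO]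
    refine lintegral_mono fun x => ?_
    refine (mul_le_mul_right (hK _ (h.post_mem hp x k)) _).trans ?_
    rw [mul_add, mul_one, mul_add, ← add_assoc]
    refine add_le_add (add_le_add le_rfl ?_) le_rfl
    exact (mul_le_mul_left (survival_le_one _ _ _) _).trans (one_mul _).le
  have hfin (n : ℕ) :
      R m ≤ (∑ j ∈ Finset.range n, S (m + j)) + K * (∑ j ∈ Finset.range n, O (m + j)) +
        R (m + n) := by
    induction n with
    | zero => simp
    | succ n ih =>
      refine ih.trans ((add_le_add_right (hstep (m + n) (by omega)) _).trans (le_of_eq ?_))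
      rw [Finset.sum_range_succ, Finset.sum_range_succ, mul_add, ← add_assoc m n 1]
      ring
  obtain ⟨C, hC, hCb⟩ := exists_hitTime_le h hA
  -- The telescoped remainder vanishes because `hitTime` is at most a constant times the inverse
  -- odds, whose mean decays geometrically.
  have hRtend : Tendsto (fun n => R (m + 1 + n)) atTop (𝓝 0) := by
    have hgeo : Tendsto (fun n => C * (ENNReal.ofReal (1 - ρ) ^ n * invOdds ρ)) atTop (𝓝 0) := by
      have h1 : ENNReal.ofReal (1 - ρ) < 1 := by
        rw [ENNReal.ofReal_lt_one]
        linarith [h.pos]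
      have h2 := ENNReal.Tendsto.mul_const (ENNReal.tendsto_pow_atTop_nhds_zero_of_lt_one h1)
        (Or.inr (invOdds_ne_top h.pos))
      simpa using ENNReal.Tendsto.const_mul h2 (Or.inr hC)
    refine tendsto_of_tendsto_of_tendsto_of_le_of_le tendsto_const_nhds hgeo
      (fun _ => zero_le) fun n => ?_
    refine le_trans ?_ (mul_le_mul_right (lintegral_invOdds_post_succ_le (B := B) h hp hm n) C)
    simp only [hR]
    rw [← lintegral_const_mul _ (h.measurable_comp_post measurable_invOdds _)]
    refine lintegral_mono fun x => ?_
    refine (mul_le_mul_left (survival_le_one _ _ _) _).trans ?_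
    rw [one_mul]
    exact hCb _ (h.post_mem hp x _)
  have hbd (n : ℕ) : R m ≤ ((∑' j, S (m + j)) + K * ∑' j, O (m + j)) + R (m + 1 + n) := by
    refine (hfin (n + 1)).trans ?_
    rw [show m + (n + 1) = m + 1 + n by omega]
    gcongr
    · exact ENNReal.sum_le_tsum _
    · exact ENNReal.sum_le_tsum _
  have htend := hRtend.const_add ((∑' j, S (m + j)) + K * ∑' j, O (m + j))
  rw [add_zero] at htend
  exact ge_of_tendsto' htend hbd

theorem lintegral_firstAbove (h : Admissible μ f₀ f₁ ρ) (ℓ : ℕ) :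
    ∫⁻ x, (firstAbove (post f₀ f₁ ρ p B x) A : ℝ≥0∞) ∂changeAt μ f₀ f₁ ℓ =
      ∑' j, ∫⁻ x, survival (post f₀ f₁ ρ p B x) A j ∂changeAt μ f₀ f₁ ℓ := by
  rw [← lintegral_tsum fun j => (h.measurable_survival j).aemeasurable]
  refine lintegral_congr fun x => ?_
  simpa using (tsum_survival (post f₀ f₁ ρ p B x) A 0).symm

end Law

theorem expNu_eq_tsum {E : Type*} [MeasurableSpace E] {μ : Measure E} {f₀ f₁ : E → ℝ}
    {ρ a b : ℝ} (h : Admissible μ f₀ f₁ ρ) :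
    expNu μ f₀ f₁ ρ a b = ∑' j, ∫⁻ x,
      survival (post f₀ f₁ ρ (Real.sigmoid b) 0 x) (Real.sigmoid a) j ∂changeAt μ f₀ f₁ 1 := by
  have hb : Real.sigmoid b ∈ Set.Ico (0 : ℝ) 1 := ⟨(Real.sigmoid_pos b).le, Real.sigmoid_lt_one b⟩
  have hnu (x : ℕ → E) : nu f₀ f₁ ρ a b x =
      firstAbove (post f₀ f₁ ρ (Real.sigmoid b) 0 x) (Real.sigmoid a) := by
    rw [nu, shiryaev_eq_post h.dens₀.nonneg h.dens₁.nonneg h.pos h.lt_one hb]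
  simp only [expNu, hnu]
  exact lintegral_firstAbove h 1

/-- `hitTime` solves the first step equation exactly, so it is both a supersolution and a
subsolution with `K = 0`. The assumption `b < a` matters because `nu` looks only at times `k ≥ 1`,
whereas `hitTime` is zero above the level. -/
theorem expNu_eq_hitTime {E : Type*} [MeasurableSpace E] {μ : Measure E} {f₀ f₁ : E → ℝ}
    {ρ a b : ℝ} (h : Admissible μ f₀ f₁ ρ) (hab : b < a) :
    expNu μ f₀ f₁ ρ a b = hitTime μ f₀ f₁ ρ (Real.sigmoid a) (Real.sigmoid b) := by
  have := h.isProbabilityMeasure_changeAt 1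
  have hb : Real.sigmoid b ∈ Set.Ico (0 : ℝ) 1 := ⟨(Real.sigmoid_pos b).le, Real.sigmoid_lt_one b⟩
  have hba : Real.sigmoid b ≤ Real.sigmoid a := Real.sigmoid_le hab.le
  have hfix {q : ℝ} (hq : q ∈ Set.Ico (0 : ℝ) 1) (hqA : q ≤ Real.sigmoid a) :
      hitTime μ f₀ f₁ ρ (Real.sigmoid a) q =
        1 + ∫⁻ y, hitTime μ f₀ f₁ ρ (Real.sigmoid a) (stepUpdate f₀ f₁ ρ 0 y q) ∂law μ f₁ := by
    simp only [stepUpdate_zero _ hq.1]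
    exact hitTime_eq h hqA
  rw [expNu_eq_tsum h]
  apply le_antisymm
  · have := tsum_lintegral_survival_le h hb (ℓ := 1) (m := 0) le_rfl (Or.inr hba)
      h.measurable_hitTime (B := 0) fun q hq hqA => (hfix hq hqA).ge
    simpa [survival_zero, post] using this
  · have := lintegral_survival_mul_hitTime_le h (Real.sigmoid_lt_one a) hb (ℓ := 1) (m := 0)
      le_rfl (B := 0) (K := 0) fun q hq => ?_
    · simpa [survival_zero, post] using this
    · rw [zero_mul, zero_add]
      rcases le_or_gt q (Real.sigmoid a) with hqA | hqA
      · exact (hfix hq hqA).le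
      · rw [hitTime_of_lt hqA]
        exact zero_le

end QuickestChange

/-! ### Extended nonnegative reals: series and asymptotic equivalence. -/

theorem ENNReal.tsum_eq_zero_add_nat (f : ℕ → ℝ≥0∞) : ∑' k, f k = f 0 + ∑' k, f (k + 1) :=
  tsum_eq_zero_add' ENNReal.summable

theorem ENNReal.tsum_ite_le_nat (f : ℕ → ℝ≥0∞) (m : ℕ) :
    ∑' k, (if m ≤ k then f k else 0) = ∑' j, f (m + j) := by
  rw [← Summable.sum_add_tsum_nat_add' (k := m) ENNReal.summable, Finset.sum_eq_zero, zero_add]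
  · exact tsum_congr fun j => by rw [if_pos (by omega), add_comm]
  · intro k hk
    rw [if_neg (not_le.2 (Finset.mem_range.1 hk))]

/-- Two functions that differ by a bounded amount, one of them tending to infinity, are
asymptotically equivalent, also after a renormalisation tending to `1`. -/
theorem ENNReal.isEquivalent_toReal_of_bounded_diff {ι : Type*} {l : Filter ι}
    {f N G c : ι → ℝ≥0∞} {C C' : ℝ≥0∞} (hC : C ≠ ∞) (hC' : C' ≠ ∞)
    (hN : Tendsto N l (𝓝 ∞)) (hNtop : ∀ᶠ i in l, N i ≠ ∞) (hG : Tendsto G l (𝓝 1))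
    (hGc : ∀ᶠ i in l, G i ≤ c i) (hc : ∀ᶠ i in l, c i ≤ 1)
    (hup : ∀ᶠ i in l, f i ≤ N i + C) (hlow : ∀ᶠ i in l, N i * G i ≤ f i + C') :
    (fun i => ((c i)⁻¹ * f i).toReal) ~[l] fun i => (N i).toReal := by
  have hN0 : ∀ᶠ i in l, N i ≠ 0 := by
    filter_upwards [ENNReal.tendsto_nhds_top_iff_nat.1 hN 0] with i hi
    exact (zero_le.trans_lt hi).ne'
  have hc1 : Tendsto c l (𝓝 1) :=
    tendsto_of_tendsto_of_tendsto_of_le_of_le' hG tendsto_const_nhds hGc hc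
  have hdiv {D : ℝ≥0∞} (hD : D ≠ ∞) : Tendsto (fun i => D / N i) l (𝓝 0) := by
    simpa using ENNReal.Tendsto.const_div hN (Or.inr hD)
  have hinv : Tendsto (fun i => (c i)⁻¹) l (𝓝 1) := by
    simpa using hc1.inv
  have hupper : Tendsto (fun i => (c i)⁻¹ * (1 + C / N i)) l (𝓝 1) := by
    have h1 : Tendsto (fun i => 1 + C / N i) l (𝓝 1) := by simpa using (hdiv hC).const_add 1
    simpa using ENNReal.Tendsto.mul hinv (Or.inr ENNReal.one_ne_top) h1
      (Or.inr ENNReal.one_ne_top)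
  have hlower : Tendsto (fun i => G i - C' / N i) l (𝓝 1) := by
    simpa using ENNReal.Tendsto.sub hG (hdiv hC') (Or.inl ENNReal.one_ne_top)
  -- The ratio is squeezed between `G - C' / N`, using `c⁻¹ ≥ 1`, and `c⁻¹ * (1 + C / N)`.
  have hratio : Tendsto (fun i => (c i)⁻¹ * f i / N i) l (𝓝 1) := by
    refine tendsto_of_tendsto_of_tendsto_of_le_of_le' hlower hupper ?_ ?_
    · filter_upwards [hN0, hNtop, hc, hlow] with i h0 htop hci hi
      have hinv1 : 1 ≤ (c i)⁻¹ := ENNReal.one_le_inv.2 hci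
      refine le_trans ?_ (ENNReal.div_le_div_right (le_mul_of_one_le_left zero_le hinv1) _)
      rw [tsub_le_iff_right, ← ENNReal.add_div, ENNReal.le_div_iff_mul_le (Or.inl h0)
        (Or.inl htop), mul_comm]
      exact hi
    · filter_upwards [hN0, hNtop, hup] with i h0 htop hi
      rw [mul_div_assoc]
      gcongr
      rw [ENNReal.div_le_iff h0 htop, add_mul, one_mul, ENNReal.div_mul_cancel h0 htop]
      exact hi
  refine isEquivalent_of_tendsto_one ?_
  have := (ENNReal.tendsto_toReal ENNReal.one_ne_top).comp hratio
  simpa [Function.comp_def, ENNReal.toReal_div, Pi.div_def] using this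

/-! ### Averaging over the change point. -/

namespace QuickestChange

section Joint

variable {E : Type*} [MeasurableSpace E] {μ : Measure E} {f₀ f₁ : E → ℝ} {ρ π₀ B A : ℝ}

theorem prior_nonneg (hρ₀ : 0 < ρ) (hρ₁ : ρ < 1) (hπ : π₀ ∈ Set.Ico (0 : ℝ) 1) (k : ℕ) :
    0 ≤ prior ρ π₀ k := by
  have h1 : 0 ≤ 1 - ρ := by linarith
  have h2 : 0 ≤ 1 - π₀ := by linarith [hπ.2]
  unfold prior
  split_ifs
  · exact hπ.1
  · positivity

theorem hasSum_prior (hρ₀ : 0 < ρ) (hρ₁ : ρ < 1) : HasSum (prior ρ π₀) 1 := by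
  have hgeo := (hasSum_geometric_of_lt_one (by linarith : 0 ≤ 1 - ρ) (by linarith)).mul_left
    ((1 - π₀) * ρ)
  have hval : (1 - π₀) * ρ * (1 - (1 - ρ))⁻¹ = 1 - π₀ := by
    rw [sub_sub_cancel, mul_inv_cancel_right₀ hρ₀.ne']
  rw [hval] at hgeo
  have hs : HasSum (fun k => prior ρ π₀ (k + 1)) (1 - π₀) := by simpa [prior] using hgeo
  have := (hasSum_nat_add_iff (f := prior ρ π₀) 1).1 hs
  simpa [prior] using this

theorem tsum_ofReal_prior (hρ₀ : 0 < ρ) (hρ₁ : ρ < 1) (hπ : π₀ ∈ Set.Ico (0 : ℝ) 1) :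
    ∑' k, ENNReal.ofReal (prior ρ π₀ k) = 1 := by
  rw [← ENNReal.ofReal_tsum_of_nonneg (prior_nonneg hρ₀ hρ₁ hπ) (hasSum_prior hρ₀ hρ₁).summable,
    (hasSum_prior hρ₀ hρ₁).tsum_eq, ENNReal.ofReal_one]

theorem lintegral_jointLaw {H : ℕ × (ℕ → E) → ℝ≥0∞} (hH : Measurable H) :
    ∫⁻ ω, H ω ∂jointLaw μ f₀ f₁ ρ π₀ = ∑' ℓ, ENNReal.ofReal (prior ρ π₀ ℓ) *
      ∫⁻ x, H (ℓ, x) ∂changeAt μ f₀ f₁ ℓ := by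
  rw [jointLaw, lintegral_sum_measure]
  refine tsum_congr fun ℓ => ?_
  rw [lintegral_smul_measure, lintegral_map hH measurable_prodMk_left, smul_eq_mul]

theorem isProbabilityMeasure_jointLaw (h : Admissible μ f₀ f₁ ρ) (hπ : π₀ ∈ Set.Ico (0 : ℝ) 1) :
    IsProbabilityMeasure (jointLaw μ f₀ f₁ ρ π₀) := by
  refine ⟨?_⟩
  have (ℓ : ℕ) := h.isProbabilityMeasure_changeAt ℓ
  rw [← lintegral_one, lintegral_jointLaw measurable_const]
  simpa using tsum_ofReal_prior h.pos h.lt_one hπ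

/-- A comparison of the expectations for all change points carries over to the joint law. -/
theorem lintegral_jointLaw_le (h : Admissible μ f₀ f₁ ρ) (hπ : π₀ ∈ Set.Ico (0 : ℝ) 1)
    {H H' : ℕ × (ℕ → E) → ℝ≥0∞} (hH : Measurable H) (hH' : Measurable H') {C : ℝ≥0∞}
    (hle : ∀ ℓ, ∫⁻ x, H (ℓ, x) ∂changeAt μ f₀ f₁ ℓ ≤
      (∫⁻ x, H' (ℓ, x) ∂changeAt μ f₀ f₁ ℓ) + C) :
    ∫⁻ ω, H ω ∂jointLaw μ f₀ f₁ ρ π₀ ≤ (∫⁻ ω, H' ω ∂jointLaw μ f₀ f₁ ρ π₀) + C := by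
  rw [lintegral_jointLaw hH, lintegral_jointLaw hH']
  calc _ ≤ ∑' ℓ, ENNReal.ofReal (prior ρ π₀ ℓ) *
        ((∫⁻ x, H' (ℓ, x) ∂changeAt μ f₀ f₁ ℓ) + C) := by
        gcongr with ℓ
        exact hle ℓ
    _ = _ := by
        simp only [mul_add]
        rw [ENNReal.tsum_add, ENNReal.tsum_mul_right, tsum_ofReal_prior h.pos h.lt_one hπ, one_mul]

theorem Admissible.measurable_joint_post (h : Admissible μ f₀ f₁ ρ) (k : ℕ → ℕ) :
    Measurable fun ω : ℕ × (ℕ → E) => post f₀ f₁ ρ π₀ B ω.2 (k ω.1) :=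
  measurable_from_prod_countable_right fun ℓ => h.measurable_post (k ℓ)

theorem Admissible.measurable_joint_survival (h : Admissible μ f₀ f₁ ρ) (k : ℕ → ℕ) :
    Measurable fun ω : ℕ × (ℕ → E) => survival (post f₀ f₁ ρ π₀ B ω.2) A (k ω.1) :=
  measurable_from_prod_countable_right fun ℓ => h.measurable_survival (k ℓ)

/-- The number of steps from just before the change (from the start, if the change is at time
`0`) to the alarm. -/
noncomputable def activeTime (f₀ f₁ : E → ℝ) (ρ π₀ B A : ℝ) (ω : ℕ × (ℕ → E)) : ℝ≥0∞ :=
  ∑' j, survival (post f₀ f₁ ρ π₀ B ω.2) A (ω.1 - 1 + j)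

theorem Admissible.measurable_activeTime (h : Admissible μ f₀ f₁ ρ) :
    Measurable (activeTime f₀ f₁ ρ π₀ B A) :=
  Measurable.tsum fun j => h.measurable_joint_survival fun ℓ => ℓ - 1 + j

theorem lintegral_activeTime_changeAt (h : Admissible μ f₀ f₁ ρ) (ℓ : ℕ) :
    ∫⁻ x, activeTime f₀ f₁ ρ π₀ B A (ℓ, x) ∂changeAt μ f₀ f₁ ℓ =
      ∑' j, ∫⁻ x, survival (post f₀ f₁ ρ π₀ B x) A (ℓ - 1 + j) ∂changeAt μ f₀ f₁ ℓ :=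
  lintegral_tsum fun j => (h.measurable_survival (ℓ - 1 + j)).aemeasurable

theorem lintegral_activeTime_le (h : Admissible μ f₀ f₁ ρ) (hπ : π₀ ∈ Set.Ico (0 : ℝ) 1)
    (hB : B ∈ Set.Ioo (0 : ℝ) 1) :
    ∫⁻ ω, activeTime f₀ f₁ ρ π₀ B A ω ∂jointLaw μ f₀ f₁ ρ π₀ ≤
      hitTime μ f₀ f₁ ρ A B + (1 + oddsConst ρ B * invOdds ρ) := by
  have := isProbabilityMeasure_jointLaw h hπ
  have hle := lintegral_jointLaw_le h hπ (h.measurable_activeTime (π₀ := π₀) (B := B) (A := A))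
    (H' := fun _ => 0) measurable_const
    (C := hitTime μ f₀ f₁ ρ A B + (1 + oddsConst ρ B * invOdds ρ)) fun ℓ => ?_
  · simpa using hle
  have := h.isProbabilityMeasure_changeAt ℓ
  have hℓ : ℓ ≤ ℓ - 1 + 1 := by omega
  -- The term at time `ℓ - 1` is split off and bounded by `1`: the posterior there has no control on
  -- its inverse odds. One step later, at time `max ℓ 1`, their mean is at most `invOdds ρ`, and the
  -- supersolution with `s = B` applies.
  rw [lintegral_zero, zero_add, lintegral_activeTime_changeAt h, ENNReal.tsum_eq_zero_add_nat,
    add_left_comm]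
  refine add_le_add ?_ ?_
  · exact (lintegral_mono fun x => survival_le_one _ _ _).trans (by simp)
  · have h1 := tsum_lintegral_survival_le h hπ (ℓ := ℓ) (m := ℓ - 1 + 1) (A := A) (by omega)
      (Or.inl (by omega)) (h.measurable_superSol B)
      fun q hq hqA => one_add_lintegral_superSol_le h hB le_rfl hq hqA
    have h2 : ∫⁻ x, survival (post f₀ f₁ ρ π₀ B x) A (ℓ - 1 + 1) *
        superSol μ f₀ f₁ ρ A B (post f₀ f₁ ρ π₀ B x (ℓ - 1 + 1)) ∂changeAt μ f₀ f₁ ℓ ≤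
        hitTime μ f₀ f₁ ρ A B + oddsConst ρ B * invOdds ρ := by
      have h3 := lintegral_invOdds_post_succ_le (B := B) h hπ hℓ 0
      rw [pow_zero, one_mul, add_zero] at h3
      refine le_trans ?_ (add_le_add_right (mul_le_mul_right h3 _) _)
      rw [← lintegral_const_mul _ (h.measurable_comp_post measurable_invOdds _)]
      calc _ ≤ ∫⁻ x, (hitTime μ f₀ f₁ ρ A B +
            oddsConst ρ B * invOdds (post f₀ f₁ ρ π₀ B x (ℓ - 1 + 1))) ∂changeAt μ f₀ f₁ ℓ := by
            refine lintegral_mono fun x => ?_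
            refine (mul_le_mul_left (survival_le_one _ _ _) _).trans ?_
            rw [one_mul, superSol]
            have hmem := h.post_mem hπ x (ℓ - 1 + 1) (B := B)
            gcongr
            exact hitTime_antitoneOn h (Set.Ioo_subset_Ico_self hB)
              ⟨hB.1.le.trans (le_max_right _ _), max_lt hmem.2 hB.2⟩ (le_max_right _ _)
        _ = _ := by
            rw [lintegral_add_left measurable_const]
            simp
    refine le_trans (le_of_eq ?_) (h1.trans h2)
    exact tsum_congr fun j => by rw [add_right_comm, add_assoc, add_comm j 1, ← add_assoc]

theorem lintegral_hitTime_post_le (h : Admissible μ f₀ f₁ ρ) (hπ : π₀ ∈ Set.Ico (0 : ℝ) 1)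
    (hA : A < 1) :
    ∫⁻ ω, survival (post f₀ f₁ ρ π₀ B ω.2) A (ω.1 - 1 + 1) *
        hitTime μ f₀ f₁ ρ A (post f₀ f₁ ρ π₀ B ω.2 (ω.1 - 1 + 1)) ∂jointLaw μ f₀ f₁ ρ π₀ ≤
      (∫⁻ ω, activeTime f₀ f₁ ρ π₀ B A ω ∂jointLaw μ f₀ f₁ ρ π₀) +
        oddsConst ρ (skipUpdate ρ B) * oddsBound ρ := by
  refine lintegral_jointLaw_le h hπ ((h.measurable_joint_survival fun ℓ => ℓ - 1 + 1).mul
    (h.measurable_hitTime.comp (h.measurable_joint_post fun ℓ => ℓ - 1 + 1)))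
    h.measurable_activeTime fun ℓ => ?_
  rw [lintegral_activeTime_changeAt h]
  refine (lintegral_survival_mul_hitTime_le h hA hπ (m := ℓ - 1 + 1) (by omega)
    fun q hq => hitTime_le_stepUpdate h hq).trans ?_
  refine add_le_add ?_ (mul_le_mul_right (tsum_lintegral_invOdds_post_le h hπ (by omega)) _)
  rw [ENNReal.tsum_eq_zero_add_nat fun j =>
    ∫⁻ x, survival (post f₀ f₁ ρ π₀ B x) A (ℓ - 1 + j) ∂changeAt μ f₀ f₁ ℓ]
  refine le_trans (le_of_eq ?_) le_add_self
  exact tsum_congr fun j => by rw [add_right_comm, add_assoc]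

theorem hitTime_le_hitTime_add_of_mem_Ico (h : Admissible μ f₀ f₁ ρ) {s p : ℝ}
    (hs : s ∈ Set.Ico (0 : ℝ) 1) (hp : p ∈ Set.Ico (0 : ℝ) 1) :
    hitTime μ f₀ f₁ ρ A p ≤ hitTime μ f₀ f₁ ρ A s + oddsConst ρ s * invOdds p := by
  -- At `s = 0` monotonicity alone suffices, since `hitTime` is largest there.
  rcases hs.1.eq_or_lt with h0 | h0
  · exact (hitTime_antitoneOn h hs hp (h0 ▸ hp.1)).trans le_self_add
  · exact hitTime_le_hitTime_add h ⟨h0, hs.2⟩ hp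

/-- A normalised lower bound for the active time: the probability that there is no alarm up to
the change, corrected for the overshoot of the posterior at the change. -/
noncomputable def survivalRatio (μ : Measure E) (f₀ f₁ : E → ℝ) (ρ π₀ B A : ℝ) : ℝ≥0∞ :=
  ∫⁻ ω, survival (post f₀ f₁ ρ π₀ B ω.2) A (ω.1 - 1 + 1) *
    (1 - oddsConst ρ (post f₀ f₁ ρ π₀ B ω.2 (ω.1 - 1 + 1)) * invOdds B / hitTime μ f₀ f₁ ρ A B)
      ∂jointLaw μ f₀ f₁ ρ π₀

theorem measurable_oddsConst : Measurable (oddsConst ρ) :=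
  (measurable_invOdds.const_mul _).inv

theorem Admissible.measurable_survivalRatio_integrand (h : Admissible μ f₀ f₁ ρ) (N : ℝ≥0∞) :
    Measurable fun ω : ℕ × (ℕ → E) => survival (post f₀ f₁ ρ π₀ B ω.2) A (ω.1 - 1 + 1) *
      (1 - oddsConst ρ (post f₀ f₁ ρ π₀ B ω.2 (ω.1 - 1 + 1)) * invOdds B / N) :=
  (h.measurable_joint_survival fun ℓ => ℓ - 1 + 1).mul (measurable_const.sub
    (((measurable_oddsConst.comp (h.measurable_joint_post fun ℓ => ℓ - 1 + 1)).mul_const _).div_const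
      _))

theorem hitTime_ne_top (h : Admissible μ f₀ f₁ ρ) (hA : A < 1) (hB : B ∈ Set.Ioo (0 : ℝ) 1) :
    hitTime μ f₀ f₁ ρ A B ≠ ∞ := by
  obtain ⟨C, hC, hCb⟩ := exists_hitTime_le h hA
  exact ne_top_of_le_ne_top (ENNReal.mul_ne_top hC (invOdds_ne_top hB.1))
    (hCb B (Set.Ioo_subset_Ico_self hB))

/-- At the posterior `p` of time `max Γ 1`, `hitTime` is at least its value at `B` minus `oddsConst
ρ p * invOdds B`. Factoring out the value at `B` leaves the integrand of `survivalRatio`. -/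
theorem hitTime_mul_survivalRatio_le (h : Admissible μ f₀ f₁ ρ) (hπ : π₀ ∈ Set.Ico (0 : ℝ) 1)
    (hA : A < 1) (hB : B ∈ Set.Ioo (0 : ℝ) 1) :
    hitTime μ f₀ f₁ ρ A B * survivalRatio μ f₀ f₁ ρ π₀ B A ≤
      (∫⁻ ω, activeTime f₀ f₁ ρ π₀ B A ω ∂jointLaw μ f₀ f₁ ρ π₀) +
        oddsConst ρ (skipUpdate ρ B) * oddsBound ρ := by
  refine le_trans ?_ (lintegral_hitTime_post_le h hπ hA)
  rw [survivalRatio, ← lintegral_const_mul _ (h.measurable_survivalRatio_integrand _)]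
  refine lintegral_mono fun ω => ?_
  rw [mul_left_comm]
  gcongr
  have htop := hitTime_ne_top h hA hB
  rcases eq_or_ne (hitTime μ f₀ f₁ ρ A B) 0 with h0 | h0
  · simp [h0]
  · rw [ENNReal.mul_sub fun _ _ => htop, mul_one, ENNReal.mul_div_cancel h0 htop,
      tsub_le_iff_right]
    exact hitTime_le_hitTime_add_of_mem_Ico h (h.post_mem hπ _ _) (Set.Ioo_subset_Ico_self hB)

/-- Only finitely many posteriors are involved, all below `1`, and the alarm level tends to `1`. -/
theorem tendsto_survival (h : Admissible μ f₀ f₁ ρ) (hπ : π₀ ∈ Set.Ico (0 : ℝ) 1) (x : ℕ → E)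
    (k : ℕ) : ∀ᶠ a : ℝ in atTop, survival (post f₀ f₁ ρ π₀ B x) (Real.sigmoid a) k = 1 := by
  have hev : ∀ᶠ a : ℝ in atTop, ∀ i ∈ Finset.range (k + 1),
      post f₀ f₁ ρ π₀ B x i < Real.sigmoid a := by
    rw [Filter.eventually_all_finset]
    exact fun i _ => Real.tendsto_sigmoid_atTop.eventually_const_lt (h.post_mem hπ x i).2
  filter_upwards [hev] with a ha
  rw [survival, if_pos]
  rw [natCast_lt_firstAbove]
  exact fun i _ hik => (ha i (Finset.mem_range.2 (by omega))).le

/-- Each survival probability tends to `1`, so the first `n + 1` terms of the series for `E_1[ν_b]`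
eventually exceed `n`. -/
theorem tendsto_hitTime (h : Admissible μ f₀ f₁ ρ) (b : ℝ) :
    Tendsto (fun a => hitTime μ f₀ f₁ ρ (Real.sigmoid a) (Real.sigmoid b)) atTop (𝓝 ∞) := by
  have := h.isProbabilityMeasure_changeAt 1
  have hb : Real.sigmoid b ∈ Set.Ico (0 : ℝ) 1 := ⟨(Real.sigmoid_pos b).le, Real.sigmoid_lt_one b⟩
  have hk (k : ℕ) : Tendsto (fun a => ∫⁻ x, survival (post f₀ f₁ ρ (Real.sigmoid b) 0 x)
      (Real.sigmoid a) k ∂changeAt μ f₀ f₁ 1) atTop (𝓝 1) := by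
    have := tendsto_lintegral_filter_of_dominated_convergence (μ := changeAt μ f₀ f₁ 1)
      (F := fun a x => survival (post f₀ f₁ ρ (Real.sigmoid b) 0 x) (Real.sigmoid a) k)
      (f := fun _ => 1) (fun _ => 1) (l := atTop)
      (.of_forall fun a => h.measurable_survival k)
      (.of_forall fun a => .of_forall fun x => survival_le_one _ _ _) (by simp)
      (.of_forall fun x => tendsto_const_nhds.congr'
        ((tendsto_survival h hb x k).mono fun a ha => ha.symm))
    simpa using this
  rw [ENNReal.tendsto_nhds_top_iff_nat]
  intro n
  have hsum := tendsto_finsetSum (Finset.range (n + 1)) fun k _ => hk k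
  have hn : (n : ℝ≥0∞) < ∑ k ∈ Finset.range (n + 1), 1 := by
    simp only [Finset.sum_const, Finset.card_range, nsmul_eq_mul, mul_one]
    exact_mod_cast Nat.lt_succ_self n
  filter_upwards [hsum.eventually_const_lt hn, eventually_gt_atTop b] with a ha hab
  refine ha.trans_le ?_
  rw [← expNu_eq_hitTime h hab, expNu_eq_tsum h]
  exact ENNReal.sum_le_tsum _

/-- Truncated subtraction keeps the integrand below `1`, so dominated convergence needs no
integrability of the overshoot correction. Pointwise this correction is a finite number divided by a
quantity tending to infinity. -/
theorem tendsto_survivalRatio (h : Admissible μ f₀ f₁ ρ) (hπ : π₀ ∈ Set.Ico (0 : ℝ) 1) (b : ℝ) :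
    Tendsto (fun a => survivalRatio μ f₀ f₁ ρ π₀ (Real.sigmoid b) (Real.sigmoid a)) atTop
      (𝓝 1) := by
  have := isProbabilityMeasure_jointLaw h hπ
  have := tendsto_lintegral_filter_of_dominated_convergence (μ := jointLaw μ f₀ f₁ ρ π₀)
    (F := fun a ω => survival (post f₀ f₁ ρ π₀ (Real.sigmoid b) ω.2) (Real.sigmoid a)
        (ω.1 - 1 + 1) *
      (1 - oddsConst ρ (post f₀ f₁ ρ π₀ (Real.sigmoid b) ω.2 (ω.1 - 1 + 1)) *
        invOdds (Real.sigmoid b) / hitTime μ f₀ f₁ ρ (Real.sigmoid a) (Real.sigmoid b)))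
    (f := fun _ => 1) (fun _ => 1) (l := atTop)
    (.of_forall fun a => h.measurable_survivalRatio_integrand _)
    (.of_forall fun a => .of_forall fun ω => mul_le_one' (survival_le_one _ _ _) tsub_le_self)
    (by simp) (.of_forall fun ω => ?_)
  · simpa [survivalRatio] using this
  · have hX : oddsConst ρ (post f₀ f₁ ρ π₀ (Real.sigmoid b) ω.2 (ω.1 - 1 + 1)) *
        invOdds (Real.sigmoid b) ≠ ∞ :=
      ENNReal.mul_ne_top (oddsConst_ne_top h (h.post_mem hπ _ _).2)
        (invOdds_ne_top (Real.sigmoid_pos b))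
    have h1 := ENNReal.Tendsto.sub (tendsto_const_nhds (x := (1 : ℝ≥0∞)))
      (ENNReal.Tendsto.const_div (tendsto_hitTime h b) (Or.inr hX)) (Or.inl ENNReal.one_ne_top)
    rw [ENNReal.div_top, tsub_zero] at h1
    refine h1.congr' ?_
    filter_upwards [tendsto_survival h hπ ω.2 (ω.1 - 1 + 1)] with a ha
    rw [ha, one_mul]

end Joint

end QuickestChange

/-! ### Conditioning on no false alarm. -/

namespace QuickestChange

section Conditioning

variable {E : Type*} {f₀ f₁ : E → ℝ} {ρ π₀ a b : ℝ}

/-- For `Γ ≥ 1`, `τ ≥ Γ` means `Γ - 1 < τ`. For `Γ = 0` truncated subtraction gives time `0`, which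
is always survived. -/
theorem mem_noFalseAlarm_iff (ω : ℕ × (ℕ → E)) :
    ω ∈ noFalseAlarm f₀ f₁ ρ π₀ a b ↔
      survival (post f₀ f₁ ρ π₀ (Real.sigmoid b) ω.2) (Real.sigmoid a) (ω.1 - 1) = 1 := by
  obtain ⟨ℓ, x⟩ := ω
  cases ℓ with
  | zero => simp [noFalseAlarm, survival_zero]
  | succ n =>
    simp only [noFalseAlarm, Set.mem_ofPred_eq, tau, survival, Nat.add_sub_cancel, Nat.cast_add,
      Nat.cast_one, ENat.add_one_le_iff (ENat.natCast_ne_top n)]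
    split_ifs with hn <;> simp [hn]

/-- The number of observations used after the change counts the times before the alarm at which
the posterior is at least the observation threshold. -/
theorem obsAfterChange_eq (ω : ℕ × (ℕ → E)) :
    obsAfterChange f₀ f₁ ρ π₀ a b ω = ∑' j,
      survival (post f₀ f₁ ρ π₀ (Real.sigmoid b) ω.2) (Real.sigmoid a) (ω.1 - 1 + j) *
        (if Real.sigmoid b ≤ post f₀ f₁ ρ π₀ (Real.sigmoid b) ω.2 (ω.1 - 1 + j) then 1 else 0) := by
  rw [obsAfterChange, ENNReal.tsum_eq_zero_add_nat,
    ← ENNReal.tsum_ite_le_nat fun k =>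
      survival (post f₀ f₁ ρ π₀ (Real.sigmoid b) ω.2) (Real.sigmoid a) k *
        (if Real.sigmoid b ≤ post f₀ f₁ ρ π₀ (Real.sigmoid b) ω.2 k then 1 else 0)]
  simp only [control, Nat.cast_zero, ite_self, zero_add]
  refine tsum_congr fun k => ?_
  simp only [tau, survival, Nat.cast_add, Nat.cast_one, ENat.add_one_le_iff (ENat.natCast_ne_top k),
    show ω.1 ≤ k + 1 ↔ ω.1 - 1 ≤ k by omega]
  split_ifs <;> simp_all

theorem obsAfterChange_le_activeTime (ω : ℕ × (ℕ → E)) :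
    obsAfterChange f₀ f₁ ρ π₀ a b ω ≤
      activeTime f₀ f₁ ρ π₀ (Real.sigmoid b) (Real.sigmoid a) ω := by
  rw [obsAfterChange_eq, activeTime]
  refine ENNReal.tsum_le_tsum fun j => ?_
  split_ifs <;> simp

/-- A skipped observation means a posterior below `B`, so its indicator is at most `invOdds p /
invOdds B`. The term at `Γ - 1` is bounded by `1` instead, since only later inverse odds have
bounded mean. -/
theorem activeTime_le_obsAfterChange_add (ω : ℕ × (ℕ → E)) :
    activeTime f₀ f₁ ρ π₀ (Real.sigmoid b) (Real.sigmoid a) ω ≤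
      obsAfterChange f₀ f₁ ρ π₀ a b ω + (1 + (invOdds (Real.sigmoid b))⁻¹ *
        ∑' j, invOdds (post f₀ f₁ ρ π₀ (Real.sigmoid b) ω.2 (ω.1 - 1 + 1 + j))) := by
  have hterm (k : ℕ) :
      survival (post f₀ f₁ ρ π₀ (Real.sigmoid b) ω.2) (Real.sigmoid a) k ≤
      survival (post f₀ f₁ ρ π₀ (Real.sigmoid b) ω.2) (Real.sigmoid a) k *
        (if Real.sigmoid b ≤ post f₀ f₁ ρ π₀ (Real.sigmoid b) ω.2 k then 1 else 0) +
      (invOdds (Real.sigmoid b))⁻¹ * invOdds (post f₀ f₁ ρ π₀ (Real.sigmoid b) ω.2 k) := by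
    split_ifs with hk
    · rw [mul_one]
      exact le_self_add
    · refine (survival_le_one _ _ _).trans (le_trans ?_ le_add_self)
      rw [← ENNReal.inv_mul_cancel (invOdds_pos (Real.sigmoid_lt_one b))
        (invOdds_ne_top (Real.sigmoid_pos b))]
      gcongr
      exact invOdds_antitone (not_le.1 hk).le
  rw [obsAfterChange_eq, activeTime, ENNReal.tsum_eq_zero_add_nat,
    ENNReal.tsum_eq_zero_add_nat fun j =>
      survival (post f₀ f₁ ρ π₀ (Real.sigmoid b) ω.2) (Real.sigmoid a) (ω.1 - 1 + j) *
        (if Real.sigmoid b ≤ post f₀ f₁ ρ π₀ (Real.sigmoid b) ω.2 (ω.1 - 1 + j) then 1 else 0),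
    ← ENNReal.tsum_mul_left, add_add_add_comm, ← ENNReal.tsum_add]
  refine add_le_add ((survival_le_one _ _ _).trans le_add_self) (ENNReal.tsum_le_tsum fun j => ?_)
  rw [← add_assoc, add_right_comm]
  exact hterm _

theorem activeTime_eq (ω : ℕ × (ℕ → E)) :
    activeTime f₀ f₁ ρ π₀ (Real.sigmoid b) (Real.sigmoid a) ω =
      (tau f₀ f₁ ρ π₀ a b ω.2 : ℝ≥0∞) - (ω.1 - 1 : ℕ) :=
  tsum_survival _ _ _

theorem delay_le_activeTime (ω : ℕ × (ℕ → E)) :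
    (tau f₀ f₁ ρ π₀ a b ω.2 : ℝ≥0∞) - (ω.1 : ℝ≥0∞) ≤
      activeTime f₀ f₁ ρ π₀ (Real.sigmoid b) (Real.sigmoid a) ω := by
  rw [activeTime_eq]
  exact tsub_le_tsub_left (by exact_mod_cast Nat.sub_le _ _) _

theorem activeTime_le_delay_add (ω : ℕ × (ℕ → E)) :
    activeTime f₀ f₁ ρ π₀ (Real.sigmoid b) (Real.sigmoid a) ω ≤
      (tau f₀ f₁ ρ π₀ a b ω.2 : ℝ≥0∞) - (ω.1 : ℝ≥0∞) + 1 := by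
  rw [activeTime_eq, tsub_le_iff_right]
  refine (le_tsub_add (b := (tau f₀ f₁ ρ π₀ a b ω.2 : ℝ≥0∞)) (a := (ω.1 : ℝ≥0∞))).trans ?_
  rw [add_assoc]
  gcongr
  exact_mod_cast (by omega : ω.1 ≤ 1 + (ω.1 - 1))

theorem survival_eq_zero_of_notMem {ω : ℕ × (ℕ → E)} (hω : ω ∉ noFalseAlarm f₀ f₁ ρ π₀ a b)
    (j : ℕ) :
    survival (post f₀ f₁ ρ π₀ (Real.sigmoid b) ω.2) (Real.sigmoid a) (ω.1 - 1 + j) = 0 := by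
  rw [mem_noFalseAlarm_iff] at hω
  induction j with
  | zero =>
    rw [survival] at hω
    rw [add_zero, survival]
    split_ifs at hω ⊢ <;> simp_all
  | succ j ih => rw [← add_assoc, survival_succ, ih, zero_mul]

theorem activeTime_eq_zero_of_notMem {ω : ℕ × (ℕ → E)}
    (hω : ω ∉ noFalseAlarm f₀ f₁ ρ π₀ a b) :
    activeTime f₀ f₁ ρ π₀ (Real.sigmoid b) (Real.sigmoid a) ω = 0 := by
  simp [activeTime, survival_eq_zero_of_notMem hω]

variable [MeasurableSpace E] {μ : Measure E}

theorem measurableSet_noFalseAlarm (h : Admissible μ f₀ f₁ ρ) :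
    MeasurableSet (noFalseAlarm f₀ f₁ ρ π₀ a b) := by
  have : noFalseAlarm f₀ f₁ ρ π₀ a b = (fun ω : ℕ × (ℕ → E) =>
      survival (post f₀ f₁ ρ π₀ (Real.sigmoid b) ω.2) (Real.sigmoid a) (ω.1 - 1)) ⁻¹' {1} :=
    Set.ext mem_noFalseAlarm_iff
  rw [this]
  exact h.measurable_joint_survival (fun ℓ => ℓ - 1) (measurableSet_singleton 1)

theorem Admissible.measurable_obsAfterChange (h : Admissible μ f₀ f₁ ρ) :
    Measurable (obsAfterChange f₀ f₁ ρ π₀ a b) := by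
  have : obsAfterChange f₀ f₁ ρ π₀ a b = _ := funext obsAfterChange_eq
  rw [this]
  exact Measurable.tsum fun j => (h.measurable_joint_survival fun ℓ => ℓ - 1 + j).mul
    (Measurable.ite (measurableSet_le measurable_const
      (h.measurable_joint_post fun ℓ => ℓ - 1 + j)) measurable_const measurable_const)

/-- The active time, and with it `H`, vanishes after a false alarm, so conditioning merely divides
by the probability of the event. -/
theorem lintegral_cond_noFalseAlarm (h : Admissible μ f₀ f₁ ρ) {H : ℕ × (ℕ → E) → ℝ≥0∞}
    (hH : ∀ ω, H ω ≤ activeTime f₀ f₁ ρ π₀ (Real.sigmoid b) (Real.sigmoid a) ω) :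
    ∫⁻ ω, H ω ∂(ProbabilityTheory.cond (jointLaw μ f₀ f₁ ρ π₀) (noFalseAlarm f₀ f₁ ρ π₀ a b)) =
      (jointLaw μ f₀ f₁ ρ π₀ (noFalseAlarm f₀ f₁ ρ π₀ a b))⁻¹ *
        ∫⁻ ω, H ω ∂jointLaw μ f₀ f₁ ρ π₀ := by
  rw [ProbabilityTheory.cond, lintegral_smul_measure, smul_eq_mul,
    ← lintegral_indicator (measurableSet_noFalseAlarm h)]
  congr 1
  refine lintegral_congr fun ω => ?_
  by_cases hω : ω ∈ noFalseAlarm f₀ f₁ ρ π₀ a b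
  · rw [Set.indicator_of_mem hω]
  · rw [Set.indicator_of_notMem hω]
    exact (le_antisymm ((hH ω).trans (activeTime_eq_zero_of_notMem hω).le) zero_le).symm

theorem ano₁_eq (h : Admissible μ f₀ f₁ ρ) : ano₁ μ f₀ f₁ ρ π₀ a b =
    (jointLaw μ f₀ f₁ ρ π₀ (noFalseAlarm f₀ f₁ ρ π₀ a b))⁻¹ *
      ∫⁻ ω, obsAfterChange f₀ f₁ ρ π₀ a b ω ∂jointLaw μ f₀ f₁ ρ π₀ :=
  lintegral_cond_noFalseAlarm h obsAfterChange_le_activeTime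

theorem condDelay_eq (h : Admissible μ f₀ f₁ ρ) : condDelay μ f₀ f₁ ρ π₀ a b =
    (jointLaw μ f₀ f₁ ρ π₀ (noFalseAlarm f₀ f₁ ρ π₀ a b))⁻¹ *
      ∫⁻ ω, ((tau f₀ f₁ ρ π₀ a b ω.2 : ℝ≥0∞) - (ω.1 : ℝ≥0∞)) ∂jointLaw μ f₀ f₁ ρ π₀ :=
  lintegral_cond_noFalseAlarm h delay_le_activeTime

/-- Since `survivalRatio` tends to `1`, this bound also forces the probability of no false alarm to
tend to `1`. -/
theorem survivalRatio_le_measure (h : Admissible μ f₀ f₁ ρ) :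
    survivalRatio μ f₀ f₁ ρ π₀ (Real.sigmoid b) (Real.sigmoid a) ≤
      jointLaw μ f₀ f₁ ρ π₀ (noFalseAlarm f₀ f₁ ρ π₀ a b) := by
  rw [← lintegral_indicator_one (measurableSet_noFalseAlarm h), survivalRatio]
  refine lintegral_mono fun ω => ?_
  by_cases hω : ω ∈ noFalseAlarm f₀ f₁ ρ π₀ a b
  · rw [Set.indicator_of_mem hω]
    exact mul_le_one' (survival_le_one _ _ _) tsub_le_self
  · rw [survival_eq_zero_of_notMem hω, zero_mul]
    exact zero_le

/-- A functional dominated by the active time has a finite conditional expectation. -/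
theorem inv_measure_mul_lintegral_ne_top (h : Admissible μ f₀ f₁ ρ)
    (hπ : π₀ ∈ Set.Ico (0 : ℝ) 1) {H : ℕ × (ℕ → E) → ℝ≥0∞}
    (hH : ∀ ω, H ω ≤ activeTime f₀ f₁ ρ π₀ (Real.sigmoid b) (Real.sigmoid a) ω) :
    (jointLaw μ f₀ f₁ ρ π₀ (noFalseAlarm f₀ f₁ ρ π₀ a b))⁻¹ *
      ∫⁻ ω, H ω ∂jointLaw μ f₀ f₁ ρ π₀ ≠ ∞ := by
  have hb : Real.sigmoid b ∈ Set.Ioo (0 : ℝ) 1 := ⟨Real.sigmoid_pos b, Real.sigmoid_lt_one b⟩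
  rcases eq_or_ne (jointLaw μ f₀ f₁ ρ π₀ (noFalseAlarm f₀ f₁ ρ π₀ a b)) 0 with h0 | h0
  -- The factor `0⁻¹ = ∞` does no harm: conditioning on a null event gives the zero measure.
  · rw [← lintegral_cond_noFalseAlarm h hH, ProbabilityTheory.cond,
      Measure.restrict_eq_zero.2 h0]
    simp
  · refine ENNReal.mul_ne_top (ENNReal.inv_ne_top.2 h0) ?_
    refine ne_top_of_le_ne_top ?_ ((lintegral_mono hH).trans (lintegral_activeTime_le h hπ hb))
    exact ENNReal.add_ne_top.2 ⟨hitTime_ne_top h (Real.sigmoid_lt_one a) hb,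
      ENNReal.add_ne_top.2 ⟨ENNReal.one_ne_top,
        ENNReal.mul_ne_top (oddsConst_ne_top h hb.2) (invOdds_ne_top h.pos)⟩⟩

theorem lintegral_activeTime_le_obsAfterChange_add (h : Admissible μ f₀ f₁ ρ)
    (hπ : π₀ ∈ Set.Ico (0 : ℝ) 1) :
    ∫⁻ ω, activeTime f₀ f₁ ρ π₀ (Real.sigmoid b) (Real.sigmoid a) ω ∂jointLaw μ f₀ f₁ ρ π₀ ≤
      (∫⁻ ω, obsAfterChange f₀ f₁ ρ π₀ a b ω ∂jointLaw μ f₀ f₁ ρ π₀) +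
        (1 + (invOdds (Real.sigmoid b))⁻¹ * oddsBound ρ) := by
  refine lintegral_jointLaw_le h hπ h.measurable_activeTime h.measurable_obsAfterChange
    fun ℓ => ?_
  have := h.isProbabilityMeasure_changeAt ℓ
  have hobs : Measurable fun x : ℕ → E => obsAfterChange f₀ f₁ ρ π₀ a b (ℓ, x) :=
    h.measurable_obsAfterChange.comp measurable_prodMk_left
  have hodds : Measurable fun x : ℕ → E =>
      ∑' j, invOdds (post f₀ f₁ ρ π₀ (Real.sigmoid b) x (ℓ - 1 + 1 + j)) :=
    Measurable.tsum fun j => h.measurable_comp_post measurable_invOdds _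
  refine (lintegral_mono fun x => activeTime_le_obsAfterChange_add (ℓ, x)).trans ?_
  rw [lintegral_add_left hobs, lintegral_add_left measurable_const, lintegral_const_mul _ hodds,
    lintegral_tsum fun j => (h.measurable_comp_post measurable_invOdds _).aemeasurable]
  gcongr
  · simp
  · exact tsum_lintegral_invOdds_post_le h hπ (by omega)

/-- A functional within bounded expected distance below the active time has a conditional
expectation given no false alarm which is asymptotically equivalent to `E_1[ν_b]`. -/
theorem isEquivalent_expNu (h : Admissible μ f₀ f₁ ρ) (hπ : π₀ ∈ Set.Ico (0 : ℝ) 1)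
    {H : ℝ → ℕ × (ℕ → E) → ℝ≥0∞} {C : ℝ≥0∞} (hC : C ≠ ∞)
    (hup : ∀ a ω, H a ω ≤ activeTime f₀ f₁ ρ π₀ (Real.sigmoid b) (Real.sigmoid a) ω)
    (hlow : ∀ a, ∫⁻ ω, activeTime f₀ f₁ ρ π₀ (Real.sigmoid b) (Real.sigmoid a) ω
      ∂jointLaw μ f₀ f₁ ρ π₀ ≤ (∫⁻ ω, H a ω ∂jointLaw μ f₀ f₁ ρ π₀) + C) :
    (fun a => ((jointLaw μ f₀ f₁ ρ π₀ (noFalseAlarm f₀ f₁ ρ π₀ a b))⁻¹ *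
      ∫⁻ ω, H a ω ∂jointLaw μ f₀ f₁ ρ π₀).toReal) ~[atTop]
      fun a => (expNu μ f₀ f₁ ρ a b).toReal := by
  have := isProbabilityMeasure_jointLaw h hπ
  have hb : Real.sigmoid b ∈ Set.Ioo (0 : ℝ) 1 := ⟨Real.sigmoid_pos b, Real.sigmoid_lt_one b⟩
  have hsb := QuickestChange.skipUpdate_mem h.pos h.lt_one (Set.Ioo_subset_Ico_self hb)
  have heq : (fun a => (hitTime μ f₀ f₁ ρ (Real.sigmoid a) (Real.sigmoid b)).toReal) =ᶠ[atTop]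
      fun a => (expNu μ f₀ f₁ ρ a b).toReal := by
    filter_upwards [eventually_gt_atTop b] with a hab
    rw [expNu_eq_hitTime h hab]
  refine IsEquivalent.congr_right (ENNReal.isEquivalent_toReal_of_bounded_diff
    (C := 1 + oddsConst ρ (Real.sigmoid b) * invOdds ρ)
    (C' := C + oddsConst ρ (skipUpdate ρ (Real.sigmoid b)) * oddsBound ρ) ?_ ?_
    (tendsto_hitTime h b) (.of_forall fun a => hitTime_ne_top h (Real.sigmoid_lt_one a) hb)
    (tendsto_survivalRatio h hπ b) (.of_forall fun a => survivalRatio_le_measure h)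
    (.of_forall fun a => prob_le_one) (.of_forall fun a => ?_) (.of_forall fun a => ?_)) heq
  · exact ENNReal.add_ne_top.2 ⟨ENNReal.one_ne_top,
      ENNReal.mul_ne_top (oddsConst_ne_top h hb.2) (invOdds_ne_top h.pos)⟩
  · exact ENNReal.add_ne_top.2 ⟨hC,
      ENNReal.mul_ne_top (oddsConst_ne_top h hsb.2) (oddsBound_ne_top h)⟩
  · exact (lintegral_mono (hup a)).trans (lintegral_activeTime_le h hπ hb)
  · refine (hitTime_mul_survivalRatio_le h hπ (Real.sigmoid_lt_one a) hb).trans ?_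
    rw [← add_assoc]
    gcongr
    exact hlow a

end Conditioning

end QuickestChange

/-! ### Conclusion: both functionals are compared with the expected Shiryaev time. -/

theorem mainTheorem8 {E : Type*} [MeasurableSpace E] (μ : Measure E) (f₀ f₁ : E → ℝ)
    (hf₀ : QuickestChange.IsProbDensity μ f₀) (hf₁ : QuickestChange.IsProbDensity μ f₁)
    (hL : ∀ᵐ x ∂μ, f₀ x = 0 → f₁ x = 0)
    (ρ π₀ b : ℝ) (hρ₀ : 0 < ρ) (hρ₁ : ρ < 1) (hπ₀ : 0 ≤ π₀) (hπ₁ : π₀ < 1) :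
    (∀ a : ℝ, b < a →
      QuickestChange.ano₁ μ f₀ f₁ ρ π₀ a b ≠ ∞ ∧
      QuickestChange.expNu μ f₀ f₁ ρ a b ≠ ∞ ∧
      QuickestChange.condDelay μ f₀ f₁ ρ π₀ a b ≠ ∞) ∧
    (fun a : ℝ => (QuickestChange.ano₁ μ f₀ f₁ ρ π₀ a b).toReal) ~[atTop]
      (fun a : ℝ => (QuickestChange.expNu μ f₀ f₁ ρ a b).toReal) ∧
    (fun a : ℝ => (QuickestChange.ano₁ μ f₀ f₁ ρ π₀ a b).toReal) ~[atTop]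
      (fun a : ℝ => (QuickestChange.condDelay μ f₀ f₁ ρ π₀ a b).toReal) := by
  have h : QuickestChange.Admissible μ f₀ f₁ ρ := ⟨hf₀, hf₁, hL, hρ₀, hρ₁⟩
  have hπ : π₀ ∈ Set.Ico (0 : ℝ) 1 := ⟨hπ₀, hπ₁⟩
  have hb : Real.sigmoid b ∈ Set.Ioo (0 : ℝ) 1 := ⟨Real.sigmoid_pos b, Real.sigmoid_lt_one b⟩
  have := QuickestChange.isProbabilityMeasure_jointLaw h hπ
  have hano : (fun a : ℝ => (QuickestChange.ano₁ μ f₀ f₁ ρ π₀ a b).toReal) ~[atTop]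
      (fun a : ℝ => (QuickestChange.expNu μ f₀ f₁ ρ a b).toReal) := by
    simp only [QuickestChange.ano₁_eq h]
    refine QuickestChange.isEquivalent_expNu h hπ
      (C := 1 + (QuickestChange.invOdds (Real.sigmoid b))⁻¹ * QuickestChange.oddsBound ρ) ?_
      (fun a => QuickestChange.obsAfterChange_le_activeTime)
      (fun a => QuickestChange.lintegral_activeTime_le_obsAfterChange_add h hπ)
    exact ENNReal.add_ne_top.2 ⟨ENNReal.one_ne_top, ENNReal.mul_ne_top
      (ENNReal.inv_ne_top.2 (QuickestChange.invOdds_pos hb.2))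
      (QuickestChange.oddsBound_ne_top h)⟩
  have hdelay : (fun a : ℝ => (QuickestChange.condDelay μ f₀ f₁ ρ π₀ a b).toReal) ~[atTop]
      (fun a : ℝ => (QuickestChange.expNu μ f₀ f₁ ρ a b).toReal) := by
    simp only [QuickestChange.condDelay_eq h]
    refine QuickestChange.isEquivalent_expNu h hπ (C := 1) ENNReal.one_ne_top
      (fun a => QuickestChange.delay_le_activeTime) fun a => ?_
    refine (lintegral_mono QuickestChange.activeTime_le_delay_add).trans ?_
    rw [lintegral_add_right _ measurable_const]
    simp
  refine ⟨fun a hab => ⟨?_, ?_, ?_⟩, hano, hano.trans hdelay.symm⟩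
  · rw [QuickestChange.ano₁_eq h]
    exact QuickestChange.inv_measure_mul_lintegral_ne_top h hπ
      QuickestChange.obsAfterChange_le_activeTime
  · rw [QuickestChange.expNu_eq_hitTime h hab]
    exact QuickestChange.hitTime_ne_top h (Real.sigmoid_lt_one a) hb
  · rw [QuickestChange.condDelay_eq h]
    exact QuickestChange.inv_measure_mul_lintegral_ne_top h hπ
      QuickestChange.delay_le_activeTime
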